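/- Let $X$ be a locally compact second countable Hausdorff space, $\mu$ a nonnegative Radon measure on $X$ with $\mu(U)>0$ for every nonempty open $U\subset X$, and $(\mathcal{E},\mathcal{F})$ a regular symmetric Dirichlet form on the real space $L_2(X,\mu)$. Let $C_0(X)$ be the space of continuous real functions with compact support and $\mathcal{C}:=C_0(X)\cap\mathcal{F}$. For $g,h\in\mathcal{C}$ there is a unique finite signed Borel measure $\Gamma(g,h)$ on $X$ such that $$2\int_X f\,d\Gamma(g,h)=\mathcal{E}(fg,h)+\mathcal{E}(fh,g)-\mathcal{E}(gh,f)\qquad\text{for all } f\in\mathcal{C}$$ (all the products are in $\mathcal{C}$). Let $\mathcal{B}_b(X)$ be the space of bounded Borel functions on $X$. There is a unique nonnegative definite symmetric bilinear form on $\mathcal{C}\otimes\mathcal{B}_b(X)$ with $$\langle a\otimes b,c\otimes d\rangle_{\mathcal{H}}=\int_X bd\,d\Gamma(a,c);$$ let $\|\cdot\|_{\mathcal{H}}$ be its seminorm and let the Hilbert space $\mathcal{H}$ be the completion of $(\mathcal{C}\otimes\mathcal{B}_b(X))/\ker\|\cdot\|_{\mathcal{H}}$. The class of $a\otimes b$ in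 $\mathcal{H}$ is again written $a\otimes b$. Write $\mathcal{M}(X)$ for the space of finite signed Radon measures on $X$ (which are all the finite signed Borel measures). Then there is a symmetric bilinear map $\Gamma_{\mathcal{H}}:\mathcal{H}\times\mathcal{H}\to\mathcal{M}(X)$ with the following properties. 1. $\Gamma_{\mathcal{H}}(a\otimes b,c\otimes d)=bd\,\Gamma(a,c)$ for all $a,c\in\mathcal{C}$ and $b,d\in\mathcal{B}_b(X)$. 2. $\Gamma_{\mathcal{H}}(\omega,\omega)$ is a nonnegative measure for every $\omega\in\mathcal{H}$. 3. $\Gamma_{\mathcal{H}}(\omega,\eta)(X)=\langle\omega,\eta\rangle_{\mathcal{H}}$ for all $\omega,\eta\in\mathcal{H}$. 4. For every $\varphi\in\mathcal{B}_b(X)$ the map $(\omega,\eta)\mapsto\int_X\varphi\,d\Gamma_{\mathcal{H}}(\omega,\eta)$ is continuous on $\mathcal{H}\times\mathcal{H}$. Moreover, $\Gamma_{\mathcal{H}}$ is unique in each of the following two senses. Let $G:\mathcal{H}\times\mathcal{H}\to\mathcal{M}(X)$ be a symmetric bilinear map that satisfies 1. Then $G=\Gamma_{\mathcal{H}}$ if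 all $G(\omega,\omega)$ are nonnegative measures with $G(\omega,\omega)(X)=\|\omega\|_{\mathcal{H}}^2$; and also $G=\Gamma_{\mathcal{H}}$ if $\omega\mapsto\int_X f\,dG(\omega,\eta)$ is continuous on $\mathcal{H}$ for all $\eta\in\mathcal{H}$ and $f\in C_0(X)$. -/

import Mathlib

open MeasureTheory
open scoped CompactlySupported TensorProduct

noncomputable section

/-- A symmetric Dirichlet form on the real space `L²(X, μ)`: a densely defined, nonnegative,
symmetric bilinear form which is closed and Markovian (the unit contraction operates). -/
structure DirichletForm {X : Type*} [MeasurableSpace X] (μ : Measure X) where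
  /-- the domain `ℱ` -/
  domain : Submodule ℝ (Lp ℝ 2 μ)
  /-- the form `ℰ` -/
  form : domain →ₗ[ℝ] domain →ₗ[ℝ] ℝ
  dense_domain : Dense (domain : Set (Lp ℝ 2 μ))
  symm : ∀ u v, form u v = form v u
  nonneg : ∀ u, 0 ≤ form u u
  /-- `ℱ` is complete for the norm given by `ℰ₁(u) = ℰ(u) + ‖u‖²`. -/
  closed : ∀ u : ℕ → domain,
    (∀ ε > 0, ∃ N, ∀ m ≥ N, ∀ n ≥ N,
      form (u m - u n) (u m - u n) + ‖((u m - u n : domain) : Lp ℝ 2 μ)‖ ^ 2 < ε) →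
    ∃ v : domain, Filter.Tendsto
      (fun n => form (u n - v) (u n - v) + ‖((u n - v : domain) : Lp ℝ 2 μ)‖ ^ 2)
      Filter.atTop (nhds 0)
  /-- `u ∈ ℱ` implies `(0 ∨ u) ∧ 1 ∈ ℱ`, and the energy does not increase. -/
  markov : ∀ u : domain, ∃ v : domain,
    ((v : Lp ℝ 2 μ) : X → ℝ) =ᵐ[μ] (fun x => min (max ((u : Lp ℝ 2 μ) x) 0) 1) ∧
      form v v ≤ form u u

/-- The class in `L²(X, μ)` of a continuous function with compact support. -/
def toL2 {X : Type*} [TopologicalSpace X] [MeasurableSpace X] [BorelSpace X]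
    (μ : Measure X) [IsFiniteMeasureOnCompacts μ] : C_c(X, ℝ) →ₗ[ℝ] Lp ℝ 2 μ where
  toFun f := (f.continuous.memLp_of_hasCompactSupport (p := 2) (μ := μ) f.hasCompactSupport).toLp f
  map_add' _ _ := rfl
  map_smul' _ _ := rfl

/-- The space `ℬ_b(X)` of bounded Borel functions. -/
def BoundedBorel (X : Type*) [MeasurableSpace X] : Submodule ℝ (X → ℝ) where
  carrier := {b | Measurable b ∧ ∃ K : ℝ, ∀ x, |b x| ≤ K}
  zero_mem' := ⟨measurable_const, 0, fun x => by simp⟩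
  add_mem' := by
    rintro a b ⟨ha, K, hK⟩ ⟨hb, L, hL⟩
    exact ⟨ha.add hb, K + L, fun x => (abs_add_le _ _).trans (add_le_add (hK x) (hL x))⟩
  smul_mem' := by
    rintro r b ⟨hb, K, hK⟩
    refine ⟨hb.const_smul r, |r| * K, fun x => ?_⟩
    simpa [abs_mul] using mul_le_mul_of_nonneg_left (hK x) (abs_nonneg r)

/-- The finite signed measure `b ν` with density `b` with respect to the finite signed measure
`ν`. -/
def MeasureTheory.SignedMeasure.density {X : Type*} [MeasurableSpace X]
    (ν : SignedMeasure X) (b : X → ℝ) : SignedMeasure X :=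
  VectorMeasure.withDensity ν b (ContinuousLinearMap.lsmul ℝ ℝ).flip

namespace DirichletForm

variable {X : Type*} [TopologicalSpace X] [MeasurableSpace X] [BorelSpace X]
  {μ : Measure X} [IsFiniteMeasureOnCompacts μ]

/-- The space `𝒞 = C_0(X) ∩ ℱ` of continuous functions with compact support in the domain. -/
def core (D : DirichletForm μ) : Submodule ℝ C_c(X, ℝ) :=
  D.domain.comap (toL2 μ)

/-- The inclusion of `𝒞` in `ℱ`. -/
def coreToDomain (D : DirichletForm μ) (g : D.core) : D.domain :=
  ⟨toL2 μ g, g.2⟩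

/-- The energy `ℰ(g, h)` for `g, h ∈ 𝒞`. -/
def energy (D : DirichletForm μ) (g h : D.core) : ℝ :=
  D.form (D.coreToDomain g) (D.coreToDomain h)

/-- The form is regular: `𝒞` is dense in `ℱ` for the norm of `ℰ₁`, and it is uniformly dense in
the continuous functions with compact support. -/
structure IsRegular (D : DirichletForm μ) : Prop where
  dense_domain : ∀ u : D.domain, ∀ ε > 0, ∃ g : D.core,
    D.form (u - D.coreToDomain g) (u - D.coreToDomain g) +
      ‖((u - D.coreToDomain g : D.domain) : Lp ℝ 2 μ)‖ ^ 2 < ε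
  dense_uniform : ∀ f : C_c(X, ℝ), ∀ ε > 0, ∃ g : D.core, ∀ x, |f x - (g : C_c(X, ℝ)) x| < ε

/-- `ν` is the mutual energy measure of `g, h ∈ 𝒞`: for all `f ∈ 𝒞` the products `fg`, `fh`, `gh`
belong to `𝒞` and `2 ∫ f dν = ℰ(fg, h) + ℰ(fh, g) - ℰ(gh, f)`. -/
def IsEnergyMeasure (D : DirichletForm μ) (g h : D.core) (ν : SignedMeasure X) : Prop :=
  ∀ f : D.core, ∃ (hfg : (f * g : C_c(X, ℝ)) ∈ D.core) (hfh : (f * h : C_c(X, ℝ)) ∈ D.core)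
    (hgh : (g * h : C_c(X, ℝ)) ∈ D.core),
    2 * ∫ᵛ x, (f : C_c(X, ℝ)) x ∂<•ν =
      D.energy ⟨f * g, hfg⟩ h + D.energy ⟨f * h, hfh⟩ g - D.energy ⟨g * h, hgh⟩ f

open Classical in
/-- The mutual energy measure `Γ(g, h)`, the finite signed measure with the defining property
`IsEnergyMeasure` (zero if there were none). -/
def energyMeasure (D : DirichletForm μ) (g h : D.core) : SignedMeasure X :=
  if H : ∃ ν, D.IsEnergyMeasure g h ν then H.choose else 0

/-- The space `𝒞 ⊗ ℬ_b(X)`. -/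
def PreOneForm (D : DirichletForm μ) : Type _ := D.core ⊗[ℝ] BoundedBorel X

instance (D : DirichletForm μ) : AddCommGroup D.PreOneForm :=
  TensorProduct.addCommGroup (R := ℝ) (M := D.core) (N := BoundedBorel X)

instance (D : DirichletForm μ) : Module ℝ D.PreOneForm :=
  inferInstanceAs (Module ℝ (D.core ⊗[ℝ] BoundedBorel X))

/-- The simple tensor `a ⊗ b` in `𝒞 ⊗ ℬ_b(X)`. -/
def preTmul (D : DirichletForm μ) (a : D.core) (b : BoundedBorel X) : D.PreOneForm :=
  a ⊗ₜ[ℝ] b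

/-- `B` is a nonnegative definite symmetric bilinear form on `𝒞 ⊗ ℬ_b(X)` with
`B(a ⊗ b, c ⊗ d) = ∫ b d dΓ(a, c)`. -/
structure IsOneFormProduct (D : DirichletForm μ) (B : D.PreOneForm →ₗ[ℝ] D.PreOneForm →ₗ[ℝ] ℝ) :
    Prop where
  symm : ∀ s t, B s t = B t s
  nonneg : ∀ t, 0 ≤ B t t
  tmul : ∀ (a c : D.core) (b d : BoundedBorel X),
    B (D.preTmul a b) (D.preTmul c d) =
      ∫ᵛ x, (b : X → ℝ) x * (d : X → ℝ) x ∂<•(D.energyMeasure a c)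

open Classical in
/-- The form `⟨·, ·⟩_ℋ` on `𝒞 ⊗ ℬ_b(X)`. A form as in `IsOneFormProduct` is unique, because simple
tensors span (and the value is zero if there were none). -/
def oneFormProduct (D : DirichletForm μ) : D.PreOneForm →ₗ[ℝ] D.PreOneForm →ₗ[ℝ] ℝ :=
  if H : ∃ B, D.IsOneFormProduct B then H.choose else 0

theorem oneFormProduct_symm (D : DirichletForm μ) (s t : D.PreOneForm) :
    D.oneFormProduct s t = D.oneFormProduct t s := by
  unfold oneFormProduct
  split_ifs with H
  · exact H.choose_spec.symm s t
  · rfl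

theorem oneFormProduct_nonneg (D : DirichletForm μ) (t : D.PreOneForm) :
    0 ≤ D.oneFormProduct t t := by
  unfold oneFormProduct
  split_ifs with H
  · exact H.choose_spec.nonneg t
  · exact le_refl _

/-- The semi-inner product on `𝒞 ⊗ ℬ_b(X)`. -/
@[reducible] def oneFormCore (D : DirichletForm μ) : PreInnerProductSpace.Core ℝ D.PreOneForm where
  inner s t := D.oneFormProduct s t
  conj_inner_symm s t := D.oneFormProduct_symm t s
  re_inner_nonneg t := D.oneFormProduct_nonneg t
  add_left s t r := by simp
  smul_left s t r := by simp

instance (D : DirichletForm μ) : SeminormedAddCommGroup D.PreOneForm :=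
  InnerProductSpace.Core.toSeminormedAddCommGroup (c := D.oneFormCore)

instance (D : DirichletForm μ) : InnerProductSpace ℝ D.PreOneForm :=
  InnerProductSpace.ofCore D.oneFormCore

/-- The Hilbert space `ℋ` of differential 1-forms: the Hausdorff completion of `𝒞 ⊗ ℬ_b(X)` for
the seminorm `‖·‖_ℋ`, that is, the completion of the quotient by the kernel of `‖·‖_ℋ`. -/
abbrev OneForm (D : DirichletForm μ) : Type _ := UniformSpace.Completion D.PreOneForm

/-- The class of the simple tensor `a ⊗ b` in `ℋ`. -/
def tmul (D : DirichletForm μ) (a : D.core) (b : BoundedBorel X) : D.OneForm :=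
  (D.preTmul a b : UniformSpace.Completion D.PreOneForm)

/-- `G` is a symmetric bilinear map on `ℋ` with values in the finite signed measures such that
`G(a ⊗ b, c ⊗ d) = b d Γ(a, c)`. -/
structure IsEnergyExtension (D : DirichletForm μ)
    (G : D.OneForm →ₗ[ℝ] D.OneForm →ₗ[ℝ] SignedMeasure X) : Prop where
  symm : ∀ ω η, G ω η = G η ω
  tmul : ∀ (a c : D.core) (b d : BoundedBorel X),
    G (D.tmul a b) (D.tmul c d) =
      (D.energyMeasure a c).density (fun x => (b : X → ℝ) x * (d : X → ℝ) x)

end DirichletForm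

end

/-! The extension to `ℋ` rests on one estimate. On `𝒞 ⊗ ℬ_b(X)` the formula `bd Γ(a, c)` defines a
bilinear map into signed measures (`preGamma`). It is nonnegative on the diagonal: for constants
`vᵢ`, `∑ vᵢ vⱼ Γ(aᵢ, aⱼ)` is the energy measure of `∑ vᵢ aᵢ`, and variable coefficients are limits
of simple ones. Its total mass is the scalar product, so Cauchy–Schwarz on each set `A` bounds the
value at `A` by `‖s‖ ‖t‖` (`abs_preGamma_le`). Each evaluation therefore extends to `ℋ`. Since the
bound is uniform in `A`, the extended set functions are uniform limits of signed measures, hence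
signed measures (`SignedMeasure.exists_of_forall_approx`). All properties pass to `ℋ` by density. A
nonnegative extension with the right mass obeys the same bound, so density gives uniqueness; under
separate vague continuity, density is used in one variable at a time.

The energy measures themselves come from the operators `T = αG_α`, `α = n + 1`. The forms `α⟨u - Tu,
v⟩` converge to `ℰ` on `ℱ`, and an `f` on which they stay bounded lies in `ℱ`
(`exists_of_approxForm_le`). As `T` is Markovian and symmetric, the inequalities `(a² - b²)² ≤ 4M²(a
- b)²` and `0 ≤ (a - b)²` can be integrated against it. The first makes `𝒞` an algebra; the second
makes `f ↦ 2ℰ(fg, g) - ℰ(g², f)` positive, with bound `2ℰ(g, g) sup f`. Riesz representation on the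
uniformly dense lattice `𝒞` gives `Γ(g, g)`, and polarization gives `Γ(g, h)`. -/

noncomputable section

/-! ### Finite signed measures: integrals, uniqueness, uniform limits. -/

namespace MeasureTheory.SignedMeasure

variable {X : Type*} [MeasurableSpace X]

instance (ν : SignedMeasure X) : IsFiniteMeasure (VectorMeasure.variation ν) := by
  rw [← totalVariation_eq_variation]
  unfold totalVariation
  infer_instance

theorem integrable_of_bounded (ν : SignedMeasure X) {b : X → ℝ} (hb : Measurable b) {K : ℝ}
    (hK : ∀ x, |b x| ≤ K) : VectorMeasure.Integrable ν b :=
  Integrable.of_bound hb.aestronglyMeasurable K (.of_forall hK)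

/-- By the Hahn decomposition the total variation is `ν s - ν sᶜ`, two values of size at most `C`;
hence the factor 2. -/
theorem variation_real_univ_le (ν : SignedMeasure X) {C : ℝ} (h : ∀ A, MeasurableSet A → |ν A| ≤ C) :
    (VectorMeasure.variation ν).real Set.univ ≤ 2 * C := by
  obtain ⟨s, hs, hpos, hneg, hp, hn⟩ := ν.toJordanDecomposition_spec
  have h1 : (VectorMeasure.variation ν).real Set.univ = ν s - ν sᶜ := by
    rw [← totalVariation_eq_variation, totalVariation, measureReal_add_apply, hp, hn,
      ν.toMeasureOfZeroLE_real_apply hpos hs .univ, ν.toMeasureOfLEZero_real_apply hneg hs.compl .univ]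
    simp [sub_eq_add_neg]
  rw [h1]
  have := abs_le.1 (h s hs)
  have := abs_le.1 (h _ hs.compl)
  linarith

theorem abs_integral_le_variation (ν : SignedMeasure X) {K : ℝ} {b : X → ℝ}
    (hK : ∀ x, |b x| ≤ K) (hK0 : 0 ≤ K) :
    |∫ᵛ x, b x ∂<•ν| ≤ K * (VectorMeasure.variation ν).real Set.univ := by
  have h1 := VectorMeasure.norm_integral_le_of_norm_le_const (μ := ν)
    (B := (ContinuousLinearMap.lsmul ℝ ℝ : ℝ →L[ℝ] ℝ →L[ℝ] ℝ).flip) (f := b) (C := K) (.of_forall hK)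
  rw [ContinuousLinearMap.opNorm_flip] at h1
  have h2 : ‖(ContinuousLinearMap.lsmul ℝ ℝ : ℝ →L[ℝ] ℝ →L[ℝ] ℝ)‖ ≤ 1 :=
    ContinuousLinearMap.opNorm_lsmul_le
  have h0 : 0 ≤ (VectorMeasure.variation ν).real Set.univ := measureReal_nonneg
  calc _ ≤ _ := h1
    _ ≤ K * 1 * (VectorMeasure.variation ν).real Set.univ := by gcongr
    _ = _ := by ring

theorem abs_integral_le (ν : SignedMeasure X) {C K : ℝ} (h : ∀ A, MeasurableSet A → |ν A| ≤ C)
    {b : X → ℝ} (hK : ∀ x, |b x| ≤ K) (hK0 : 0 ≤ K) :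
    |∫ᵛ x, b x ∂<•ν| ≤ K * (2 * C) :=
  (ν.abs_integral_le_variation hK hK0).trans
    (mul_le_mul_of_nonneg_left (ν.variation_real_univ_le h) hK0)

theorem integral_eq_sub (ν : SignedMeasure X) {b : X → ℝ} (hb : Measurable b) {K : ℝ}
    (hK : ∀ x, |b x| ≤ K) :
    ∫ᵛ x, b x ∂<•ν = ∫ x, b x ∂ν.toJordanDecomposition.posPart -
      ∫ x, b x ∂ν.toJordanDecomposition.negPart := by
  conv_lhs => rw [← ν.toSignedMeasure_toJordanDecomposition, JordanDecomposition.toSignedMeasure]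
  rw [VectorMeasure.integral_sub_vectorMeasure (integrable_of_bounded _ hb hK)
    (integrable_of_bounded _ hb hK), VectorMeasure.integral_toSignedMeasure,
    VectorMeasure.integral_toSignedMeasure]

/-- Moving the negative Jordan parts to the other side leaves an equality between finite nonnegative
measures, which are determined by their integrals over `C_c(X, ℝ)`. -/
theorem ext_of_integral_eq [TopologicalSpace X] [T2Space X] [LocallyCompactSpace X]
    [SecondCountableTopology X] [BorelSpace X] {ν ν' : SignedMeasure X}
    (h : ∀ f : C_c(X, ℝ), ∫ᵛ x, f x ∂<•ν = ∫ᵛ x, f x ∂<•ν') : ν = ν' := by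
  have key : ν.toJordanDecomposition.posPart + ν'.toJordanDecomposition.negPart =
      ν'.toJordanDecomposition.posPart + ν.toJordanDecomposition.negPart := by
    refine Measure.ext_of_integral_eq_on_compactlySupported fun f => ?_
    obtain ⟨K, hK⟩ := f.hasCompactSupport.exists_bound_of_continuous f.continuous
    have hf : ∀ ρ : Measure X, IsFiniteMeasure ρ → Integrable (⇑f) ρ := fun ρ _ =>
      Integrable.of_bound f.continuous.measurable.aestronglyMeasurable K (.of_forall hK)
    have h1 := h f
    rw [integral_eq_sub (b := f) ν f.continuous.measurable hK,
      integral_eq_sub (b := f) ν' f.continuous.measurable hK] at h1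
    rw [integral_add_measure (hf _ inferInstance) (hf _ inferInstance),
      integral_add_measure (hf _ inferInstance) (hf _ inferInstance)]
    linarith
  rw [← ν.toSignedMeasure_toJordanDecomposition, ← ν'.toSignedMeasure_toJordanDecomposition,
    JordanDecomposition.toSignedMeasure, JordanDecomposition.toSignedMeasure,
    sub_eq_sub_iff_add_eq_add, ← Measure.toSignedMeasure_add, ← Measure.toSignedMeasure_add]
  congr 1

theorem density_apply (ν : SignedMeasure X) {b : X → ℝ} (hb : Measurable b) {K : ℝ}
    (hK : ∀ x, |b x| ≤ K) (A : Set X) : ν.density b A = ∫ᵛ x in A, b x ∂<•ν :=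
  VectorMeasure.withDensity_apply (integrable_of_bounded _ hb hK)

theorem density_univ (ν : SignedMeasure X) (b : X → ℝ) :
    ν.density b Set.univ = ∫ᵛ x, b x ∂<•ν :=
  VectorMeasure.withDensity_apply_univ

/-- A set function which is a uniform limit of signed measures is a signed measure. -/
theorem exists_of_forall_approx (m : Set X → ℝ)
    (h : ∀ ε > 0, ∃ ν : SignedMeasure X, ∀ A, |ν A - m A| ≤ ε) :
    ∃ ν : SignedMeasure X, ∀ A, ν A = m A := by
  -- Transfers to `m` the value zero at the empty set and the default value zero at nonmeasurable
  -- sets.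
  have hz : ∀ A, (∀ ν : SignedMeasure X, ν A = 0) → m A = 0 := by
    intro A hA
    refine abs_eq_zero.1 (le_antisymm (le_of_forall_pos_le_add fun ε hε => ?_) (abs_nonneg _))
    obtain ⟨ν, hν⟩ := h ε hε
    simpa [hA ν] using hν A
  have hadd : ∀ (f : ℕ → Set X) (s : Finset ℕ), (∀ i, MeasurableSet (f i)) →
      Pairwise (Function.onFun Disjoint f) → m (⋃ i ∈ s, f i) = ∑ i ∈ s, m (f i) := by
    intro f s hf hd
    refine sub_eq_zero.1 (abs_eq_zero.1
      (le_antisymm (le_of_forall_pos_le_add fun ε hε => ?_) (abs_nonneg _)))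
    -- One error for each of the `s.card` summands and one for the union.
    obtain ⟨ν, hν⟩ := h (ε / (s.card + 1)) (by positivity)
    have h1 : ν (⋃ i ∈ s, f i) = ∑ i ∈ s, ν (f i) :=
      VectorMeasure.of_biUnion_finset (fun i _ j _ hij => hd hij) fun i _ => hf i
    have h2 : |∑ i ∈ s, ν (f i) - ∑ i ∈ s, m (f i)| ≤ s.card * (ε / (s.card + 1)) := by
      rw [← Finset.sum_sub_distrib]
      refine (Finset.abs_sum_le_sum_abs _ _).trans ?_
      refine (Finset.sum_le_card_nsmul _ _ _ fun i _ => hν (f i)).trans ?_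
      simp
    have h3 := hν (⋃ i ∈ s, f i)
    have h4 : s.card * (ε / (s.card + 1)) + ε / (s.card + 1) = ε := by field_simp
    rw [h1] at h3
    rw [abs_le] at *
    constructor <;> linarith
  refine ⟨⟨m, hz _ fun ν => VectorMeasure.empty ν,
    fun A hA => hz _ fun ν => VectorMeasure.not_measurable ν hA, fun f hf hd => ?_⟩, fun A => rfl⟩
  rw [HasSum, Metric.tendsto_nhds]
  intro ε hε
  obtain ⟨ν, hν⟩ := h (ε / 4) (by positivity)
  have h1 : HasSum (fun i => ν (f i)) (ν (⋃ i, f i)) := VectorMeasure.m_iUnion ν hf hd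
  rw [HasSum, Metric.tendsto_nhds] at h1
  filter_upwards [h1 (ε / 4) (by positivity)] with s hs
  have h2 : ν (⋃ i ∈ s, f i) = ∑ i ∈ s, ν (f i) :=
    VectorMeasure.of_biUnion_finset (fun i _ j _ hij => hd hij) fun i _ => hf i
  have h3 := hν (⋃ i ∈ s, f i)
  have h4 := hν (⋃ i, f i)
  rw [h2, hadd f s hf hd] at h3
  rw [Real.dist_eq, abs_lt] at *
  rw [abs_le] at *
  constructor <;> linarith

end MeasureTheory.SignedMeasure

/-! ### Hilbert space tools: weak limits and the resolvent equation. -/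

/-- A bounded sequence in a Hilbert space whose image under an injective bounded operator converges
is weakly convergent. -/
theorem exists_weak_limit_of_bounded {K L : Type*} [NormedAddCommGroup K] [InnerProductSpace ℝ K]
    [CompleteSpace K] [NormedAddCommGroup L] [InnerProductSpace ℝ L] [CompleteSpace L]
    (J : K →L[ℝ] L) (hJ : Function.Injective J) {w : ℕ → K} {C : ℝ} (hw : ∀ n, ‖w n‖ ≤ C) {y : L}
    (hy : Filter.Tendsto (fun n => J (w n)) Filter.atTop (nhds y)) :
    ∃ x, J x = y ∧ ∀ v, Filter.Tendsto (fun n => inner ℝ (w n) v) Filter.atTop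
      (nhds (inner ℝ x v)) := by
  -- Injectivity of `J` makes the range of its adjoint dense. On that range the scalar products with
  -- `w n` converge, and boundedness of `w` carries this to all vectors.
  have hdense : Dense (Set.range (ContinuousLinearMap.adjoint J)) := by
    have h1 : ((ContinuousLinearMap.adjoint J).range)ᗮ = ⊥ := by
      rw [ContinuousLinearMap.orthogonal_range, ContinuousLinearMap.adjoint_adjoint]
      exact LinearMap.ker_eq_bot.2 hJ
    have h2 := Submodule.dense_iff_topologicalClosure_eq_top.2
      ((Submodule.topologicalClosure_eq_top_iff (K := (ContinuousLinearMap.adjoint J).range)).2 h1)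
    exact h2
  have hC : 0 ≤ C := (norm_nonneg _).trans (hw 0)
  have hconv : ∀ f : L, Filter.Tendsto (fun n => inner ℝ (w n) (ContinuousLinearMap.adjoint J f))
      Filter.atTop (nhds (inner ℝ y f)) := by
    intro f
    simp_rw [ContinuousLinearMap.adjoint_inner_right]
    exact hy.inner tendsto_const_nhds
  have hcauchy : ∀ v, ∃ l, Filter.Tendsto (fun n => inner ℝ (w n) v) Filter.atTop (nhds l) := by
    intro v
    refine cauchySeq_tendsto_of_complete (Metric.cauchySeq_iff'.2 fun ε hε => ?_)
    obtain ⟨_, hf, ⟨f, rfl⟩⟩ := Metric.dense_iff.1 hdense v (ε / (4 * (C + 1))) (by positivity)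
    obtain ⟨N, hN⟩ := Metric.cauchySeq_iff'.1 (hconv f).cauchySeq (ε / 4) (by positivity)
    refine ⟨N, fun n hn => ?_⟩
    have h1 := hN n hn
    have h2 : ∀ k, |inner ℝ (w k) (v - ContinuousLinearMap.adjoint J f)| ≤ ε / 4 := by
      intro k
      refine (abs_real_inner_le_norm _ _).trans ?_
      have h3 : ‖v - ContinuousLinearMap.adjoint J f‖ ≤ ε / (4 * (C + 1)) := by
        rw [← dist_eq_norm, dist_comm]
        exact (Metric.mem_ball.1 hf).le
      calc _ ≤ C * (ε / (4 * (C + 1))) := mul_le_mul (hw k) h3 (norm_nonneg _) hC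
        _ ≤ (C + 1) * (ε / (4 * (C + 1))) := by gcongr; linarith
        _ = ε / 4 := by field_simp
    have h4 := h2 n
    have h5 := h2 N
    rw [inner_sub_right, abs_le] at h4 h5
    rw [Real.dist_eq, abs_lt] at *
    constructor <;> linarith
  choose l hl using hcauchy
  -- The pointwise limit functional is continuous by Banach–Steinhaus; its Riesz representative is
  -- the weak limit.
  have hl' : Filter.Tendsto (fun n v => innerSL ℝ (w n) v) Filter.atTop (nhds l) :=
    tendsto_pi_nhds.2 hl
  let Λ : K →L[ℝ] ℝ := continuousLinearMapOfTendsto (fun n => innerSL ℝ (w n)) hl'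
  have hΛ : ∀ v, inner ℝ ((InnerProductSpace.toDual ℝ K).symm Λ) v = l v := fun v => by
    rw [InnerProductSpace.toDual_symm_apply]; rfl
  refine ⟨(InnerProductSpace.toDual ℝ K).symm Λ, ?_, fun v => by rw [hΛ]; exact hl v⟩
  refine ext_inner_right ℝ fun f => ?_
  rw [← ContinuousLinearMap.adjoint_inner_right, hΛ]
  exact tendsto_nhds_unique (hl _) (hconv f)

section Resolvent

variable {K L : Type*} [NormedAddCommGroup K] [InnerProductSpace ℝ K]
    [CompleteSpace K] [NormedAddCommGroup L] [InnerProductSpace ℝ L] [CompleteSpace L]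

/-- Lax–Milgram. When the scalar product of `K` is `ℰ₁`, the left side is `ℰ(Rf, v) + α⟨Rf, v⟩`, so
`R` is `αG_α`; `1 ≤ α` gives coercivity with constant 1. -/
theorem exists_resolvent (J : K →L[ℝ] L) {α : ℝ} (hα : 1 ≤ α) :
    ∃ R : L →ₗ[ℝ] K, ∀ f v, inner ℝ (R f) v + (α - 1) * inner ℝ (J (R f)) (J v) =
      α * inner ℝ f (J v) := by
  let B : K →L[ℝ] K →L[ℝ] ℝ := innerSL ℝ +
    (α - 1) • (innerSL ℝ).comp ((ContinuousLinearMap.adjoint J).comp J)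
  have hB : ∀ u v, B u v = inner ℝ u v + (α - 1) * inner ℝ (J u) (J v) := fun u v => by
    simp [B, ContinuousLinearMap.adjoint_inner_left]
    rfl
  have hc : IsCoercive B := by
    refine ⟨1, one_pos, fun u => ?_⟩
    rw [hB, real_inner_self_eq_norm_mul_norm, real_inner_self_eq_norm_mul_norm]
    have : 0 ≤ (α - 1) * (‖J u‖ * ‖J u‖) := mul_nonneg (by linarith) (by positivity)
    linarith
  refine ⟨α • (hc.continuousLinearEquivOfBilin.symm.toLinearMap ∘ₗ
    (ContinuousLinearMap.adjoint J).toLinearMap), fun f v => ?_⟩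
  rw [← hB, ← hc.continuousLinearEquivOfBilin_apply]
  simp [inner_smul_left, ContinuousLinearMap.adjoint_inner_left]

end Resolvent

/-! ### Approximation of a Dirichlet form by its resolvent. -/

namespace DirichletForm

section Hilbert

variable {X : Type*} [MeasurableSpace X] {μ : Measure X}

/-- The domain `ℱ` as a Hilbert space for the scalar product `ℰ₁(u, v) = ℰ(u, v) + ⟨u, v⟩`. -/
def FormDomain (D : DirichletForm μ) : Type _ := D.domain

variable (D : DirichletForm μ)

instance : AddCommGroup D.FormDomain := inferInstanceAs (AddCommGroup D.domain)
instance : Module ℝ D.FormDomain := inferInstanceAs (Module ℝ D.domain)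

/-- The energy `ℰ` on `ℱ`. -/
def formOn : D.FormDomain →ₗ[ℝ] D.FormDomain →ₗ[ℝ] ℝ := D.form

/-- The inclusion of `ℱ` in `L²`. -/
def inclLinear : D.FormDomain →ₗ[ℝ] Lp ℝ 2 μ := D.domain.subtype

/-- The scalar product of `ℱ`. -/
@[reducible] def formDomainCore : InnerProductSpace.Core ℝ D.FormDomain where
  inner u v := D.formOn u v + inner ℝ (D.inclLinear u) (D.inclLinear v)
  conj_inner_symm u v := by
    simp only [conj_trivial]
    rw [real_inner_comm]
    congr 1
    exact D.symm v u
  re_inner_nonneg u := add_nonneg (D.nonneg u) real_inner_self_nonneg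
  add_left u v w := by simp [inner_add_left]; ring
  smul_left u v r := by simp [inner_smul_left]; ring
  definite u h := by
    have h1 : 0 ≤ D.formOn u u := D.nonneg u
    have h2 : 0 ≤ inner ℝ (D.inclLinear u) (D.inclLinear u) := real_inner_self_nonneg
    have h3 : inner ℝ (D.inclLinear u) (D.inclLinear u) = 0 := by linarith
    exact Subtype.ext (inner_self_eq_zero.1 h3)

/-- The type synonym keeps this `ℰ₁` norm apart from the `L²` norm that `D.domain` inherits as a
subspace. -/
instance : NormedAddCommGroup D.FormDomain :=
  InnerProductSpace.Core.toNormedAddCommGroup (cd := D.formDomainCore)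

instance : InnerProductSpace ℝ D.FormDomain :=
  InnerProductSpace.ofCore D.formDomainCore.toCore

theorem formDomain_inner (u v : D.FormDomain) :
    inner ℝ u v = D.formOn u v + inner ℝ (D.inclLinear u) (D.inclLinear v) := rfl

theorem formDomain_norm_sq (u : D.FormDomain) :
    ‖u‖ ^ 2 = D.formOn u u + ‖D.inclLinear u‖ ^ 2 := by
  rw [← real_inner_self_eq_norm_sq, formDomain_inner, real_inner_self_eq_norm_sq]

theorem formOn_symm (u v : D.FormDomain) : D.formOn u v = D.formOn v u := D.symm u v

theorem formOn_nonneg (u : D.FormDomain) : 0 ≤ D.formOn u u := D.nonneg u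

instance : CompleteSpace D.FormDomain := by
  refine Metric.complete_of_cauchySeq_tendsto fun u hu => ?_
  obtain ⟨v, hv⟩ : ∃ v : D.FormDomain, Filter.Tendsto (fun n => D.formOn (u n - v) (u n - v) +
      ‖D.inclLinear (u n - v)‖ ^ 2) Filter.atTop (nhds 0) := D.closed u fun ε hε => by
    obtain ⟨N, hN⟩ := Metric.cauchySeq_iff.1 hu (Real.sqrt ε) (Real.sqrt_pos.2 hε)
    refine ⟨N, fun m hm n hn => ?_⟩
    have h1 := hN m hm n hn
    rw [dist_eq_norm] at h1
    have h2 := pow_lt_pow_left₀ h1 (norm_nonneg _) two_ne_zero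
    rw [Real.sq_sqrt hε.le, formDomain_norm_sq] at h2
    exact h2
  refine ⟨v, tendsto_iff_norm_sub_tendsto_zero.2 ?_⟩
  have h3 : Filter.Tendsto (fun n => Real.sqrt (‖(u n - v : D.FormDomain)‖ ^ 2)) Filter.atTop
      (nhds 0) := by
    rw [← Real.sqrt_zero]
    refine Filter.Tendsto.sqrt ?_
    simp_rw [formDomain_norm_sq]
    exact hv
  simpa [Real.sqrt_sq (norm_nonneg _)] using h3

/-- The bounded inclusion of `ℱ` in `L²`. -/
def incl : D.FormDomain →L[ℝ] Lp ℝ 2 μ :=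
  D.inclLinear.mkContinuous 1 fun u => by
    rw [one_mul]
    refine abs_le_of_sq_le_sq' ?_ (norm_nonneg _) |>.2
    rw [formDomain_norm_sq]
    linarith [D.formOn_nonneg u]

theorem incl_injective : Function.Injective D.incl := fun _ _ h => Subtype.ext h

theorem inner_eq (u v : D.FormDomain) :
    inner ℝ u v = D.formOn u v + inner ℝ (D.incl u) (D.incl v) := rfl

theorem norm_sq_eq (u : D.FormDomain) : ‖u‖ ^ 2 = D.formOn u u + ‖D.incl u‖ ^ 2 :=
  D.formDomain_norm_sq u

theorem mem_domain_iff {f : Lp ℝ 2 μ} : f ∈ D.domain ↔ ∃ u, D.incl u = f :=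
  ⟨fun h => ⟨⟨f, h⟩, rfl⟩, fun ⟨u, hu⟩ => hu ▸ u.2⟩

/-- The operator `(n + 1) G_{n + 1}`, where `G` is the resolvent of the form, as a map into `ℱ`. -/
def resolvent (n : ℕ) : Lp ℝ 2 μ →ₗ[ℝ] D.FormDomain :=
  -- The shift to `n + 1` ensures `1 ≤ α` for every `n`; the parameter called `n` in `n G_n` is this
  -- `α`.
  (exists_resolvent D.incl (α := n + 1) (by simp)).choose

theorem resolvent_spec (n : ℕ) (f : Lp ℝ 2 μ) (v : D.FormDomain) :
    D.formOn (D.resolvent n f) v =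
      (n + 1) * inner ℝ (f - D.incl (D.resolvent n f)) (D.incl v) := by
  have h := (exists_resolvent D.incl (α := n + 1) (by simp)).choose_spec f v
  change inner ℝ (D.resolvent n f) v + _ * inner ℝ (D.incl (D.resolvent n f)) _ = _ at h
  rw [inner_eq] at h
  rw [inner_sub_left]
  linarith

/-- The operator `n G_n` on `L²`. -/
def approx (n : ℕ) : Lp ℝ 2 μ →ₗ[ℝ] Lp ℝ 2 μ := D.incl.toLinearMap ∘ₗ D.resolvent n

theorem incl_resolvent (n : ℕ) (f : Lp ℝ 2 μ) : D.incl (D.resolvent n f) = D.approx n f := rfl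

theorem approx_symm (n : ℕ) (f g : Lp ℝ 2 μ) :
    inner ℝ (D.approx n f) g = inner ℝ f (D.approx n g) := by
  have h1 := D.resolvent_spec n f (D.resolvent n g)
  have h2 := D.resolvent_spec n g (D.resolvent n f)
  rw [formOn_symm, h2, incl_resolvent, incl_resolvent, inner_sub_left, inner_sub_left,
    real_inner_comm (D.approx n f) (D.approx n g)] at h1
  have h3 := mul_left_cancel₀ (by positivity) h1
  rw [real_inner_comm]
  linarith

/-- The approximating form `n ⟨u - n G_n u, v⟩`. -/
def approxForm (n : ℕ) (u v : Lp ℝ 2 μ) : ℝ := (n + 1) * inner ℝ (u - D.approx n u) v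

theorem approxForm_incl (n : ℕ) (u : Lp ℝ 2 μ) (v : D.FormDomain) :
    D.approxForm n u (D.incl v) = D.formOn (D.resolvent n u) v :=
  (D.resolvent_spec n u v).symm

/-- Splits the second argument as `Tu + (u - Tu)` and applies the resolvent equation to `Tu`. A
bound on the left thus bounds the energies of the resolvents. -/
theorem approxForm_self (n : ℕ) (u : Lp ℝ 2 μ) :
    D.approxForm n u u = D.formOn (D.resolvent n u) (D.resolvent n u) +
      (n + 1) * ‖u - D.approx n u‖ ^ 2 := by
  rw [resolvent_spec, incl_resolvent, approxForm, ← real_inner_self_eq_norm_sq, ← mul_add,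
    ← inner_add_right, add_sub_cancel]

/-- Variational characterization of the resolvent. -/
theorem resolvent_minimizes (n : ℕ) (f : Lp ℝ 2 μ) (v : D.FormDomain) :
    D.formOn v v + (n + 1) * ‖D.incl v - f‖ ^ 2 =
      D.formOn (D.resolvent n f) (D.resolvent n f) + (n + 1) * ‖D.approx n f - f‖ ^ 2 +
      (D.formOn (v - D.resolvent n f) (v - D.resolvent n f) +
        (n + 1) * ‖D.incl v - D.approx n f‖ ^ 2) := by
  -- The resolvent equation tested with the difference cancels the cross terms of the two expanded
  -- squares.
  have h := D.resolvent_spec n f (v - D.resolvent n f)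
  have h1 : D.incl v - f = (D.incl v - D.approx n f) + (D.approx n f - f) := by abel
  rw [h1, norm_add_sq_real]
  have h2 : D.formOn (v - D.resolvent n f) (v - D.resolvent n f) = D.formOn v v -
      D.formOn (D.resolvent n f) (D.resolvent n f)
      - 2 * D.formOn (D.resolvent n f) (v - D.resolvent n f) := by
    simp only [map_sub, LinearMap.sub_apply]
    rw [D.formOn_symm v (D.resolvent n f)]
    ring
  rw [h2, h, map_sub, incl_resolvent, ← neg_sub f, inner_neg_right, real_inner_comm]
  ring

theorem approx_energy_le (n : ℕ) (u : D.FormDomain) :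
    D.formOn (D.resolvent n (D.incl u)) (D.resolvent n (D.incl u)) +
      (n + 1) * ‖D.approx n (D.incl u) - D.incl u‖ ^ 2 ≤ D.formOn u u := by
  have h := D.resolvent_minimizes n (D.incl u) u
  rw [sub_self, norm_zero] at h
  have h1 := D.formOn_nonneg (u - D.resolvent n (D.incl u))
  have h2 : 0 ≤ ((n : ℝ) + 1) * ‖D.incl u - D.approx n (D.incl u)‖ ^ 2 := by positivity
  linarith

theorem norm_approx_le (n : ℕ) (f : Lp ℝ 2 μ) : ‖D.approx n f‖ ≤ ‖f‖ := by
  have h := D.resolvent_spec n f (D.resolvent n f)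
  have h0 := D.formOn_nonneg (D.resolvent n f)
  rw [h, incl_resolvent, inner_sub_left, real_inner_self_eq_norm_sq] at h0
  have h1 := nonneg_of_mul_nonneg_right h0 (by positivity)
  have h2 := real_inner_le_norm f (D.approx n f)
  by_contra! h3
  nlinarith [norm_nonneg (D.approx n f), norm_nonneg f]

/-- For `u ∈ ℱ`, `(n + 1) ‖Tu - u‖² ≤ ℰ(u, u)` forces convergence; contractivity and density of `ℱ`
give the rest. -/
theorem tendsto_approx (f : Lp ℝ 2 μ) :
    Filter.Tendsto (fun n => D.approx n f) Filter.atTop (nhds f) := by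
  rw [Metric.tendsto_atTop]
  intro ε hε
  obtain ⟨g, hg, hgd⟩ := Metric.dense_iff.1 D.dense_domain f (ε / 3) (by positivity)
  obtain ⟨u, rfl⟩ := D.mem_domain_iff.1 hgd
  obtain ⟨N, hN⟩ := exists_nat_gt (D.formOn u u / (ε / 3) ^ 2)
  refine ⟨N, fun n hn => ?_⟩
  have h1 : ‖D.approx n (D.incl u) - D.incl u‖ < ε / 3 := by
    refine lt_of_pow_lt_pow_left₀ 2 (by positivity) ?_
    have h2 := D.approx_energy_le n u
    have h3 := D.formOn_nonneg (D.resolvent n (D.incl u))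
    rw [div_lt_iff₀ (by positivity)] at hN
    have h4 : (N : ℝ) ≤ n := by exact_mod_cast hn
    by_contra! h5
    have h6 : (N : ℝ) * (ε / 3) ^ 2 ≤ ((n : ℝ) + 1) * ‖D.approx n (D.incl u) - D.incl u‖ ^ 2 :=
      mul_le_mul (by linarith) h5 (by positivity) (by positivity)
    linarith
  rw [Metric.mem_ball, dist_eq_norm] at hg
  have h2 : ‖D.approx n (f - D.incl u)‖ ≤ ‖f - D.incl u‖ := D.norm_approx_le n _
  rw [norm_sub_rev] at hg
  rw [dist_eq_norm]
  have h3 : D.approx n f - f = D.approx n (f - D.incl u) +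
      (D.approx n (D.incl u) - D.incl u) - (f - D.incl u) := by
    rw [map_sub]; abel
  rw [h3]
  have h4 := norm_sub_le (D.approx n (f - D.incl u) + (D.approx n (D.incl u) - D.incl u))
    (f - D.incl u)
  have h5 := norm_add_le (D.approx n (f - D.incl u)) (D.approx n (D.incl u) - D.incl u)
  linarith

/-- An element of `L²` with bounded approximating energies belongs to `ℱ`, and its approximating
forms converge. -/
theorem exists_of_approxForm_le {f : Lp ℝ 2 μ} {C : ℝ} (hC : ∀ n, D.approxForm n f f ≤ C) :
    ∃ u, D.incl u = f ∧ ∀ v, Filter.Tendsto (fun n => D.approxForm n f (D.incl v)) Filter.atTop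
      (nhds (D.formOn u v)) := by
  have hb : ∀ n, ‖D.resolvent n f‖ ≤ Real.sqrt (C + ‖f‖ ^ 2) := fun n => by
    refine Real.le_sqrt_of_sq_le ?_
    rw [norm_sq_eq]
    have h1 := D.approxForm_self n f
    have h2 : 0 ≤ ((n : ℝ) + 1) * ‖f - D.approx n f‖ ^ 2 := by positivity
    have h3 := pow_le_pow_left₀ (norm_nonneg _) (D.norm_approx_le n f) 2
    rw [incl_resolvent]
    linarith [hC n]
  -- The resolvents are bounded in `ℱ` and converge to `f` in `L²`, so they converge weakly in `ℱ`
  -- to a preimage of `f`. Subtracting the `L²` part leaves the energies.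
  obtain ⟨u, hu, hlim⟩ := exists_weak_limit_of_bounded D.incl D.incl_injective hb
    (D.tendsto_approx f)
  refine ⟨u, hu, fun v => ?_⟩
  have h1 := (hlim v).sub ((D.tendsto_approx f).inner (tendsto_const_nhds (x := D.incl v)))
  simp_rw [inner_eq, incl_resolvent, add_sub_cancel_right] at h1
  simp_rw [approxForm_incl]
  rw [hu, add_sub_cancel_right] at h1
  exact h1

theorem approxForm_le (n : ℕ) (u : D.FormDomain) :
    D.approxForm n (D.incl u) (D.incl u) ≤ D.formOn u u := by
  rw [approxForm_self, norm_sub_rev]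
  exact D.approx_energy_le n u

theorem tendsto_approxForm (u v : D.FormDomain) :
    Filter.Tendsto (fun n => D.approxForm n (D.incl u) (D.incl v)) Filter.atTop
      (nhds (D.formOn u v)) := by
  obtain ⟨w, hw, h⟩ := D.exists_of_approxForm_le fun n => D.approxForm_le n u
  rw [← D.incl_injective hw]
  convert h v using 3

/-- The operators `n G_n` are Markovian. -/
theorem approx_markov (n : ℕ) {f : Lp ℝ 2 μ} (h0 : ∀ᵐ x ∂μ, 0 ≤ f x) (h1 : ∀ᵐ x ∂μ, f x ≤ 1) :
    ∀ᵐ x ∂μ, 0 ≤ D.approx n f x ∧ D.approx n f x ≤ 1 := by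
  -- The truncation `w` of `Tf` has no more energy and, as `f` takes values in `[0, 1]`, is no
  -- farther from `f`. Since `Tf` is the unique minimizer, `w = Tf`.
  obtain ⟨w, hw, hE⟩ : ∃ w : D.FormDomain,
      (D.incl w : X → ℝ) =ᵐ[μ] (fun x => min (max (D.approx n f x) 0) 1) ∧
        D.formOn w w ≤ D.formOn (D.resolvent n f) (D.resolvent n f) :=
    D.markov (D.resolvent n f)
  have hle : ‖D.incl w - f‖ ≤ ‖D.approx n f - f‖ := by
    refine Lp.norm_le_norm_of_ae_le ?_
    filter_upwards [hw, h0, h1, Lp.coeFn_sub (D.incl w) f, Lp.coeFn_sub (D.approx n f) f]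
      with x hx h0 h1 h2 h3
    rw [h2, h3, Pi.sub_apply, Pi.sub_apply, hx, Real.norm_eq_abs, Real.norm_eq_abs]
    have h4 : min (max (D.approx n f x) 0) 1 - f x =
        min (max (D.approx n f x) 0) 1 - min (max (f x) 0) 1 := by
      rw [max_eq_left h0, min_eq_left h1]
    rw [h4]
    refine (abs_min_sub_min_le_max _ _ _ _).trans ?_
    rw [sub_self, abs_zero, max_eq_left (abs_nonneg _)]
    refine (abs_max_sub_max_le_max _ _ _ _).trans ?_
    rw [sub_self, abs_zero, max_eq_left (abs_nonneg _)]
  have h := D.resolvent_minimizes n f w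
  have h2 := D.formOn_nonneg (w - D.resolvent n f)
  have h4 := pow_le_pow_left₀ (norm_nonneg _) hle 2
  have h5 : ((n : ℝ) + 1) * ‖D.incl w - f‖ ^ 2 ≤ (n + 1) * ‖D.approx n f - f‖ ^ 2 := by gcongr
  have h6 : ((n : ℝ) + 1) * ‖D.incl w - D.approx n f‖ ^ 2 ≤ 0 := by linarith [hE]
  have h7 : ‖D.incl w - D.approx n f‖ ^ 2 = 0 := by
    have : (0 : ℝ) < n + 1 := by positivity
    nlinarith [sq_nonneg ‖D.incl w - D.approx n f‖]
  have h8 : D.incl w = D.approx n f := by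
    rw [← sub_eq_zero, ← norm_eq_zero]
    exact pow_eq_zero_iff two_ne_zero |>.1 h7
  rw [h8] at hw
  filter_upwards [hw] with x hx
  rw [hx]
  exact ⟨le_min (le_max_right _ _) zero_le_one, min_le_right _ _⟩

end Hilbert

end DirichletForm

/-! ### Compactly supported functions and integrated pointwise inequalities. -/

section CompactSupport

variable {X : Type*} [TopologicalSpace X]

theorem CompactlySupportedContinuousMap.exists_abs_le (f : C_c(X, ℝ)) :
    ∃ M, 0 < M ∧ ∀ x, |f x| ≤ M := by
  obtain ⟨K, hK⟩ := f.hasCompactSupport.exists_bound_of_continuous f.continuous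
  exact ⟨max K 1, by positivity, fun x => (hK x).trans (le_max_left _ _)⟩

theorem exists_compactlySupported_eq_one [T2Space X] [LocallyCompactSpace X] {K : Set X}
    (hK : IsCompact K) :
    ∃ χ : C_c(X, ℝ), (∀ x ∈ K, χ x = 1) ∧ (∀ x, 0 ≤ χ x) ∧ ∀ x, χ x ≤ 1 := by
  obtain ⟨f, h1, h2, -, h3⟩ := exists_continuousMap_one_of_isCompact_subset_isOpen hK isOpen_univ
    (Set.subset_univ K)
  exact ⟨⟨f, h2⟩, h1, fun x => (h3 x).1, fun x => (h3 x).2⟩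

variable [MeasurableSpace X] [BorelSpace X] {μ : Measure X} [IsFiniteMeasureOnCompacts μ]

theorem coeFn_toL2 (f : C_c(X, ℝ)) : (toL2 μ f : X → ℝ) =ᵐ[μ] f :=
  MemLp.coeFn_toLp (f.continuous.memLp_of_hasCompactSupport (p := 2) (μ := μ) f.hasCompactSupport)

theorem inner_toL2 (f : Lp ℝ 2 μ) (u : C_c(X, ℝ)) :
    inner ℝ f (toL2 μ u) = ∫ x, u x * f x ∂μ := by
  rw [L2.inner_def]
  refine integral_congr_ae ?_
  filter_upwards [coeFn_toL2 (μ := μ) u] with x hx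
  simp [hx]

theorem integrable_mul_coeFn (f : Lp ℝ 2 μ) (u : C_c(X, ℝ)) :
    Integrable (fun x => u x * f x) μ := by
  refine (L2.integrable_inner (𝕜 := ℝ) f (toL2 μ u)).congr ?_
  filter_upwards [coeFn_toL2 (μ := μ) u] with x hx
  simp [hx]

theorem inner_toL2_toL2 (f g : C_c(X, ℝ)) :
    inner ℝ (toL2 μ f) (toL2 μ g) = ∫ x, (f * g) x ∂μ := by
  rw [inner_toL2]
  refine integral_congr_ae ?_
  filter_upwards [coeFn_toL2 (μ := μ) f] with x hx
  simp [hx, mul_comm]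

/-- Integrated form of a pointwise inequality with three terms. -/
theorem inner_toL2_add_le {f₁ f₂ f₃ : Lp ℝ 2 μ} {q₁ q₂ q₃ q₀ : C_c(X, ℝ)}
    (h : ∀ᵐ x ∂μ, q₁ x * f₁ x + q₂ x * f₂ x + q₃ x * f₃ x ≤ q₀ x) :
    inner ℝ f₁ (toL2 μ q₁) + inner ℝ f₂ (toL2 μ q₂) + inner ℝ f₃ (toL2 μ q₃) ≤ ∫ x, q₀ x ∂μ := by
  have h₁₂ : Integrable (fun x => q₁ x * f₁ x + q₂ x * f₂ x) μ :=
    (integrable_mul_coeFn _ _).add (integrable_mul_coeFn _ _)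
  rw [inner_toL2, inner_toL2, inner_toL2, ← integral_add (integrable_mul_coeFn _ _)
    (integrable_mul_coeFn _ _), ← integral_add h₁₂ (integrable_mul_coeFn _ _)]
  exact integral_mono_ae (h₁₂.add (integrable_mul_coeFn _ _)) q₀.integrable h

end CompactSupport

namespace DirichletForm

variable {X : Type*} [TopologicalSpace X] [MeasurableSpace X] [BorelSpace X]
  {μ : Measure X} [IsFiniteMeasureOnCompacts μ] (D : DirichletForm μ)

theorem approx_toL2_mem_Icc (n : ℕ) {u : C_c(X, ℝ)} {k : ℝ} (hk : 0 < k) (h0 : ∀ x, 0 ≤ u x)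
    (hu : ∀ x, u x ≤ k) :
    ∀ᵐ x ∂μ, 0 ≤ D.approx n (toL2 μ u) x ∧ D.approx n (toL2 μ u) x ≤ k := by
  have h1 : ∀ x, 0 ≤ (k⁻¹ • u) x ∧ (k⁻¹ • u) x ≤ 1 := fun x => by
    rw [CompactlySupportedContinuousMap.smul_apply, smul_eq_mul]
    exact ⟨mul_nonneg (by positivity) (h0 x), by rw [inv_mul_le_one₀ hk]; exact hu x⟩
  have h2 := D.approx_markov n (f := toL2 μ (k⁻¹ • u))
    (by filter_upwards [coeFn_toL2 (μ := μ) (k⁻¹ • u)] with x hx using hx ▸ (h1 x).1)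
    (by filter_upwards [coeFn_toL2 (μ := μ) (k⁻¹ • u)] with x hx using hx ▸ (h1 x).2)
  rw [map_smul, map_smul] at h2
  filter_upwards [h2, Lp.coeFn_smul k⁻¹ (D.approx n (toL2 μ u))] with x hx hs
  rw [hs, Pi.smul_apply, smul_eq_mul, inv_mul_le_one₀ hk] at hx
  exact ⟨nonneg_of_mul_nonneg_right hx.1 (by positivity), hx.2⟩

/-- In `u = u⁺ - u⁻` the image of `u⁻` is nonnegative and that of `u⁺` is at most `k`. The case `k =
0` is separate because the two-sided bound rescales by `k⁻¹`. -/
theorem approx_toL2_le (n : ℕ) {u : C_c(X, ℝ)} {k : ℝ} (hk : 0 ≤ k) (hu : ∀ x, u x ≤ k) :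
    ∀ᵐ x ∂μ, D.approx n (toL2 μ u) x ≤ k := by
  have hu' : u = (u ⊔ 0) - ((-u) ⊔ 0) := by
    ext x
    simp only [CompactlySupportedContinuousMap.sub_apply, CompactlySupportedContinuousMap.coe_sup,
      Pi.sup_apply, CompactlySupportedContinuousMap.coe_zero, Pi.zero_apply,
      CompactlySupportedContinuousMap.coe_neg, Pi.neg_apply]
    rcases le_total 0 (u x) with h | h
    · rw [sup_eq_left.2 h, sup_eq_right.2 (by linarith)]; ring
    · rw [sup_eq_right.2 h, sup_eq_left.2 (by linarith)]; ring
  obtain ⟨M, hM, hM'⟩ := u.exists_abs_le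
  have h1 := D.approx_toL2_mem_Icc n (u := (-u) ⊔ 0) hM (fun x => by simp)
    (fun x => by simpa using ⟨neg_le.1 (abs_le.1 (hM' x)).1, hM.le⟩)
  have h2 : ∀ᵐ x ∂μ, D.approx n (toL2 μ (u ⊔ 0)) x ≤ k := by
    rcases hk.eq_or_lt with rfl | hk
    · have : u ⊔ 0 = 0 := by
        ext x
        simpa using hu x
      rw [this, map_zero, map_zero]
      filter_upwards [Lp.coeFn_zero ℝ 2 μ] with x hx
      rw [hx]; simp
    · filter_upwards [D.approx_toL2_mem_Icc n (u := u ⊔ 0) hk (fun x => by simp)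
        (fun x => by simpa using ⟨hu x, hk.le⟩)] with x hx using hx.2
  rw [hu', map_sub, map_sub]
  filter_upwards [h1, h2, Lp.coeFn_sub (D.approx n (toL2 μ (u ⊔ 0)))
    (D.approx n (toL2 μ ((-u) ⊔ 0)))] with x h1 h2 h3
  rw [h3, Pi.sub_apply]
  linarith [h1.1]

/-- A bound `∑ cᵢ(a) uᵢ ≤ k(a)` for all constants `a` survives the application of `n G_n`, also
with variable `a`. -/
theorem approx_toL2_combination_le (n : ℕ) (u₁ u₂ u₃ : C_c(X, ℝ)) {c₁ c₂ c₃ k : ℝ → ℝ}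
    (hc₁ : Continuous c₁) (hc₂ : Continuous c₂) (hc₃ : Continuous c₃) (hk : Continuous k)
    (hk0 : ∀ a, 0 ≤ k a) (h : ∀ a x, c₁ a * u₁ x + c₂ a * u₂ x + c₃ a * u₃ x ≤ k a) (g : X → ℝ) :
    ∀ᵐ x ∂μ, c₁ (g x) * D.approx n (toL2 μ u₁) x + c₂ (g x) * D.approx n (toL2 μ u₂) x +
      c₃ (g x) * D.approx n (toL2 μ u₃) x ≤ k (g x) := by
  have h1 : ∀ a : ℝ, ∀ᵐ x ∂μ, c₁ a * D.approx n (toL2 μ u₁) x +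
      c₂ a * D.approx n (toL2 μ u₂) x + c₃ a * D.approx n (toL2 μ u₃) x ≤ k a := by
    intro a
    have h2 := D.approx_toL2_le n (u := c₁ a • u₁ + c₂ a • u₂ + c₃ a • u₃) (hk0 a)
      (fun x => by simpa using h a x)
    simp only [map_add, map_smul] at h2
    filter_upwards [h2,
      Lp.coeFn_add (c₁ a • D.approx n (toL2 μ u₁) + c₂ a • D.approx n (toL2 μ u₂))
        (c₃ a • D.approx n (toL2 μ u₃)),
      Lp.coeFn_add (c₁ a • D.approx n (toL2 μ u₁)) (c₂ a • D.approx n (toL2 μ u₂)),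
      Lp.coeFn_smul (c₁ a) (D.approx n (toL2 μ u₁)), Lp.coeFn_smul (c₂ a) (D.approx n (toL2 μ u₂)),
      Lp.coeFn_smul (c₃ a) (D.approx n (toL2 μ u₃))] with x hx h3 h4 h5 h6 h7
    rw [h3, Pi.add_apply, h4, Pi.add_apply, h5, h6, h7] at hx
    exact hx
  -- Rational `a` need only countably many null sets; continuity in `a` then reaches all reals, in
  -- particular `a = g x`.
  have h2 := ae_all_iff.2 fun q : ℚ => h1 q
  filter_upwards [h2] with x hx
  have hcl : IsClosed {a : ℝ | c₁ a * D.approx n (toL2 μ u₁) x + c₂ a * D.approx n (toL2 μ u₂) x +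
      c₃ a * D.approx n (toL2 μ u₃) x ≤ k a} := isClosed_le (by fun_prop) hk
  have hd : Dense {a : ℝ | c₁ a * D.approx n (toL2 μ u₁) x + c₂ a * D.approx n (toL2 μ u₂) x +
      c₃ a * D.approx n (toL2 μ u₃) x ≤ k a} :=
    Rat.denseRange_cast.mono (by rintro _ ⟨q, rfl⟩; exact hx q)
  have := hcl.closure_eq ▸ hd (g x)
  exact this

/-- Symmetry moves the operator onto `χ`, whose image is at most 1. This is the form in which `T1 ≤
1` enters, as the constant 1 need not be in `L²`. -/
theorem inner_approx_toL2_le (n : ℕ) {χ q : C_c(X, ℝ)} (hχ : ∀ x, χ x ≤ 1) (hq : ∀ x, 0 ≤ q x) :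
    inner ℝ (D.approx n (toL2 μ q)) (toL2 μ χ) ≤ ∫ x, q x ∂μ := by
  rw [approx_symm, real_inner_comm, inner_toL2]
  refine integral_mono_ae (integrable_mul_coeFn _ _) q.integrable ?_
  filter_upwards [D.approx_toL2_le n zero_le_one hχ] with x hx
  exact mul_le_of_le_one_right (hq x) hx

theorem approxForm_toL2 (n : ℕ) (f g : C_c(X, ℝ)) :
    D.approxForm n (toL2 μ f) (toL2 μ g) =
      (n + 1) * (∫ x, (f * g) x ∂μ - inner ℝ (D.approx n (toL2 μ f)) (toL2 μ g)) := by
  rw [approxForm, inner_sub_left, inner_toL2_toL2]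

/-- Approximating energies of squares. -/
theorem approxForm_sq_le [T2Space X] [LocallyCompactSpace X] (n : ℕ) (g : C_c(X, ℝ)) {M : ℝ}
    (hM : ∀ x, |g x| ≤ M) :
    D.approxForm n (toL2 μ (g * g)) (toL2 μ (g * g)) ≤
      4 * M ^ 2 * D.approxForm n (toL2 μ g) (toL2 μ g) := by
  rcases isEmpty_or_nonempty X with hX | ⟨⟨x₀⟩⟩
  · have h0 : g = 0 := CompactlySupportedContinuousMap.eq_of_empty _ _
    simp [h0, approxForm]
  have hM0 : 0 ≤ M := (abs_nonneg _).trans (hM x₀)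
  obtain ⟨χ, hχ1, hχ0, hχ⟩ := exists_compactlySupported_eq_one g.hasCompactSupport
  have hgχ : ∀ x, g x = 0 ∨ χ x = 1 := fun x => by
    by_cases hx : x ∈ tsupport g
    · exact Or.inr (hχ1 x hx)
    · exact Or.inl (image_eq_zero_of_notMem_tsupport hx)
  -- Clamping to `[-M, M]` makes the inequality below valid for every real `a` and changes nothing
  -- at the values of `g`.
  let t : ℝ → ℝ := fun a => max (min a M) (-M)
  have ht : ∀ a, |t a| ≤ M := fun a => abs_le.2 ⟨le_max_right _ _, max_le (min_le_right _ _) (by linarith)⟩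
  have htg : ∀ x, t (g x) = g x := fun x => by
    simp only [t]
    rw [min_eq_left (abs_le.1 (hM x)).2, max_eq_left (abs_le.1 (hM x)).1]
  have htc : Continuous t := by fun_prop
  -- The coefficients come from expanding `(a² - b²)² ≤ 4M²(a - b)²` in powers of `b = g`, with `a`
  -- replaced by `t a`.
  have h1 := D.approx_toL2_combination_le n g (g * g) (g * g * (g * g))
    (c₁ := fun a => 8 * M ^ 2 * t a) (c₂ := fun a => -(4 * M ^ 2 + 2 * t a ^ 2)) (c₃ := fun _ => 1)
    (k := fun a => 4 * M ^ 2 * t a ^ 2 - t a ^ 4) (by fun_prop) (by fun_prop) (by fun_prop)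
    (by fun_prop) (fun a => by
      have h2 : t a ^ 2 ≤ M ^ 2 := sq_le_sq' (abs_le.1 (ht a)).1 (abs_le.1 (ht a)).2
      have : 0 ≤ t a ^ 2 * (4 * M ^ 2 - t a ^ 2) :=
        mul_nonneg (sq_nonneg _) (by nlinarith [sq_nonneg (t a)])
      linarith)
    (fun a x => by
      simp only [CompactlySupportedContinuousMap.mul_apply]
      have h2 := abs_le.1 (ht a)
      have h3 := abs_le.1 (hM x)
      have h4 : (t a + g x) ^ 2 ≤ (2 * M) ^ 2 := sq_le_sq' (by linarith) (by linarith)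
      have : 0 ≤ (t a - g x) ^ 2 * (4 * M ^ 2 - (t a + g x) ^ 2) :=
        mul_nonneg (sq_nonneg _) (by linarith)
      linarith) g
  simp only [htg] at h1
  -- Integration against `χ`, which is absorbed wherever a factor `g` is present.
  have h2 := inner_toL2_add_le (μ := μ) (q₁ := (8 * M ^ 2) • g)
    (q₂ := -((4 * M ^ 2) • χ + (2 : ℝ) • (g * g))) (q₃ := χ)
    (q₀ := (4 * M ^ 2) • (g * g) - g * g * (g * g)) (f₁ := D.approx n (toL2 μ g))
    (f₂ := D.approx n (toL2 μ (g * g))) (f₃ := D.approx n (toL2 μ (g * g * (g * g)))) (by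
      filter_upwards [h1] with x hx
      simp only [CompactlySupportedContinuousMap.smul_apply,
        CompactlySupportedContinuousMap.neg_apply, CompactlySupportedContinuousMap.add_apply,
        CompactlySupportedContinuousMap.sub_apply,
        CompactlySupportedContinuousMap.mul_apply, smul_eq_mul]
      rcases hgχ x with h | h
      · rw [h] at hx ⊢
        have := mul_le_mul_of_nonneg_left hx (hχ0 x)
        linarith
      · rw [h]
        linarith)
  -- Adding this estimate cancels the terms that still contain `χ`.
  have h3 := D.inner_approx_toL2_le n (χ := χ) (q := (4 * M ^ 2) • (g * g) - g * g * (g * g)) hχ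
    (fun x => by
      simp only [CompactlySupportedContinuousMap.smul_apply,
        CompactlySupportedContinuousMap.sub_apply,
        CompactlySupportedContinuousMap.mul_apply, smul_eq_mul]
      have h2 : g x ^ 2 ≤ M ^ 2 := sq_le_sq' (abs_le.1 (hM x)).1 (abs_le.1 (hM x)).2
      have : 0 ≤ g x ^ 2 * (4 * M ^ 2 - g x ^ 2) :=
        mul_nonneg (sq_nonneg _) (by nlinarith [sq_nonneg (g x)])
      linarith)
  have h4 : ∫ x, ((4 * M ^ 2) • (g * g) - g * g * (g * g)) x ∂μ =
      4 * M ^ 2 * ∫ x, (g * g) x ∂μ - ∫ x, (g * g * (g * g)) x ∂μ := by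
    rw [← integral_const_mul, ← integral_sub ((g * g).integrable.const_mul _)
      (g * g * (g * g)).integrable]
    rfl
  rw [h4] at h2 h3
  simp only [map_add, map_sub, map_neg, map_smul, inner_add_right, inner_neg_right,
    inner_smul_right, inner_sub_left, inner_smul_left, conj_trivial] at h2 h3
  rw [approxForm_toL2, approxForm_toL2]
  have h5 : ∫ x, (g * g * (g * g)) x ∂μ - inner ℝ (D.approx n (toL2 μ (g * g))) (toL2 μ (g * g)) ≤
      4 * M ^ 2 * (∫ x, (g * g) x ∂μ - inner ℝ (D.approx n (toL2 μ g)) (toL2 μ g)) := by linarith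
  have h6 := mul_le_mul_of_nonneg_left h5 (by positivity : (0 : ℝ) ≤ n + 1)
  linarith

/-- The approximating energy measures are nonnegative. -/
theorem approxForm_carre_nonneg (n : ℕ) (g : C_c(X, ℝ)) {f : C_c(X, ℝ)} (hf : ∀ x, 0 ≤ f x) :
    D.approxForm n (toL2 μ (g * g)) (toL2 μ f) ≤
      2 * D.approxForm n (toL2 μ g) (toL2 μ (f * g)) := by
  -- The coefficients expand `0 ≤ (a - b)²` with `b = g`; it is then taken at `a = g x` and
  -- integrated against `f`.
  have h1 := D.approx_toL2_combination_le n g (g * g) 0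
    (c₁ := fun a => 2 * a) (c₂ := fun a => -1) (c₃ := fun _ => 0)
    (k := fun a => a ^ 2) (by fun_prop) (by fun_prop) (by fun_prop)
    (by fun_prop) (fun a => sq_nonneg a)
    (fun a x => by
      simp only [CompactlySupportedContinuousMap.mul_apply]
      linarith [sq_nonneg (a - g x)]) g
  have h2 := inner_toL2_add_le (μ := μ) (q₁ := (2 : ℝ) • (f * g)) (q₂ := -f) (q₃ := 0)
    (q₀ := g * g * f) (f₁ := D.approx n (toL2 μ g)) (f₂ := D.approx n (toL2 μ (g * g))) (f₃ := 0) (by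
      filter_upwards [h1] with x hx
      simp only [CompactlySupportedContinuousMap.smul_apply,
        CompactlySupportedContinuousMap.neg_apply, CompactlySupportedContinuousMap.zero_apply,
        CompactlySupportedContinuousMap.mul_apply, smul_eq_mul]
      have := mul_le_mul_of_nonneg_left hx (hf x)
      linarith)
  simp only [map_neg, map_smul, inner_neg_right, inner_smul_right, inner_zero_left] at h2
  have h3 : g * (f * g) = g * g * f := by ext x; simp; ring
  rw [approxForm_toL2, approxForm_toL2, h3]
  have h4 : ∫ x, (g * g * f) x ∂μ - inner ℝ (D.approx n (toL2 μ (g * g))) (toL2 μ f) ≤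
      2 * (∫ x, (g * g * f) x ∂μ - inner ℝ (D.approx n (toL2 μ g)) (toL2 μ (f * g))) := by
    linarith
  have h5 := mul_le_mul_of_nonneg_left h4 (by positivity : (0 : ℝ) ≤ n + 1)
  linarith

/-- The approximating energy measures have at most the mass of the approximating energy. -/
theorem approxForm_carre_le [T2Space X] [LocallyCompactSpace X] (n : ℕ) (g f : C_c(X, ℝ)) {M : ℝ}
    (hM : 0 ≤ M) (hf : ∀ x, f x ≤ M) :
    2 * D.approxForm n (toL2 μ g) (toL2 μ (f * g)) - D.approxForm n (toL2 μ (g * g)) (toL2 μ f) ≤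
      2 * M * D.approxForm n (toL2 μ g) (toL2 μ g) := by
  obtain ⟨χ, hχ1, hχ0, hχ⟩ := exists_compactlySupported_eq_one
    (f.hasCompactSupport.isCompact.union g.hasCompactSupport.isCompact)
  have hgχ : χ * g = g := by
    ext x
    rw [CompactlySupportedContinuousMap.mul_apply]
    by_cases hx : x ∈ tsupport g
    · rw [hχ1 x (Or.inr hx), one_mul]
    · rw [image_eq_zero_of_notMem_tsupport hx, mul_zero]
  -- Positivity for `Mχ - f` is the upper bound for `f`, up to the term with `g²` and `χ`, which has
  -- the right sign because `T` does not increase mass.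
  have h1 := D.approxForm_carre_nonneg n g (f := M • χ - f) (fun x => by
    rw [CompactlySupportedContinuousMap.sub_apply, CompactlySupportedContinuousMap.smul_apply,
      smul_eq_mul]
    by_cases hx : x ∈ tsupport f
    · rw [hχ1 x (Or.inl hx)]
      linarith [hf x]
    · rw [image_eq_zero_of_notMem_tsupport hx, sub_zero]
      exact mul_nonneg hM (hχ0 x))
  rw [sub_mul, smul_mul_assoc, hgχ] at h1
  have h2 := D.inner_approx_toL2_le n (χ := χ) (q := g * g) hχ (fun x => mul_self_nonneg (g x))
  have h3 : 0 ≤ D.approxForm n (toL2 μ (g * g)) (toL2 μ χ) := by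
    rw [approxForm_toL2, show g * g * χ = g * g by rw [mul_assoc, mul_comm g χ, hgχ]]
    exact mul_nonneg (by positivity) (by linarith)
  have h4 : ∀ u v w : C_c(X, ℝ), D.approxForm n (toL2 μ u) (toL2 μ (M • v - w)) =
      M * D.approxForm n (toL2 μ u) (toL2 μ v) - D.approxForm n (toL2 μ u) (toL2 μ w) := by
    intro u v w
    simp only [approxForm, map_sub, map_smul, inner_sub_right, inner_smul_right]
    ring
  rw [h4, h4] at h1
  linarith [mul_nonneg hM h3]

end DirichletForm

/-! ### Riesz representation on a dense sublattice. -/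

/-- A positive bounded functional on a sublattice which is uniformly dense in `C_c(X, ℝ)` is given
by a finite measure. -/
theorem exists_finite_measure_of_functional {X : Type*} [TopologicalSpace X] [T2Space X]
    [LocallyCompactSpace X] [MeasurableSpace X] [BorelSpace X] (S : Submodule ℝ C_c(X, ℝ))
    (hdense : ∀ f : C_c(X, ℝ), ∀ ε > 0, ∃ g : S, ∀ x, |f x - (g : C_c(X, ℝ)) x| < ε)
    (hsup : ∀ f ∈ S, f ⊔ 0 ∈ S) (L : S →ₗ[ℝ] ℝ) {C : ℝ}
    (hbound : ∀ (f : S) (M : ℝ), 0 ≤ M → (∀ x, (f : C_c(X, ℝ)) x ≤ M) → L f ≤ C * M)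
    (hpos : ∀ f : S, (∀ x, 0 ≤ (f : C_c(X, ℝ)) x) → 0 ≤ L f) :
    ∃ ν : Measure X, IsFiniteMeasure ν ∧ ∀ f : S, ∫ x, (f : C_c(X, ℝ)) x ∂ν = L f := by
  -- Approximating `2χ` within 1 gives an element of `S` that is at least 1 on `K` and at most 3;
  -- its positive part is the cutoff.
  have hcut : ∀ K : Set X, IsCompact K → ∃ g : S, (∀ x, 0 ≤ (g : C_c(X, ℝ)) x) ∧
      (∀ x ∈ K, 1 ≤ (g : C_c(X, ℝ)) x) ∧ ∀ x, (g : C_c(X, ℝ)) x ≤ 3 := by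
    intro K hK
    obtain ⟨χ, hχ1, hχ0, hχ⟩ := exists_compactlySupported_eq_one hK
    obtain ⟨g, hg⟩ := hdense ((2 : ℝ) • χ) 1 one_pos
    have hg' : ∀ x, 2 * χ x - 1 ≤ (g : C_c(X, ℝ)) x ∧ (g : C_c(X, ℝ)) x ≤ 2 * χ x + 1 := fun x => by
      have h1 := abs_lt.1 (hg x)
      rw [CompactlySupportedContinuousMap.smul_apply, smul_eq_mul] at h1
      constructor <;> linarith
    refine ⟨⟨_, hsup g g.2⟩, fun x => le_max_right _ _, fun x hx => ?_, fun x => ?_⟩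
    · refine le_max_of_le_left ?_
      linarith [hg' x, hχ1 x hx]
    · refine max_le ?_ (by norm_num [CompactlySupportedContinuousMap.zero_apply])
      linarith [hg' x, hχ x]
  let P : PointedCone ℝ C_c(X, ℝ) :=
    { carrier := {f | ∀ x, 0 ≤ f x}
      add_mem' := fun hf hg x => add_nonneg (hf x) (hg x)
      zero_mem' := fun _ => le_refl _
      smul_mem' := fun c _ hf x => mul_nonneg c.2 (hf x) }
  -- The cutoffs make `S` cofinal, as the M. Riesz extension theorem for positive functionals
  -- requires.
  obtain ⟨Λ, hΛL, hΛpos⟩ := riesz_extension P ⟨S, L⟩ hpos (fun y => by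
    obtain ⟨M, hM, hyM⟩ := y.exists_abs_le
    obtain ⟨g, hg0, hg1, -⟩ := hcut _ y.hasCompactSupport
    refine ⟨M • g, fun x => ?_⟩
    change 0 ≤ M * (g : C_c(X, ℝ)) x + y x
    by_cases hx : x ∈ tsupport y
    · nlinarith [hg1 x hx, (abs_le.1 (hyM x)).1]
    · rw [image_eq_zero_of_notMem_tsupport hx, add_zero]
      exact mul_nonneg hM.le (hg0 x))
  let Λ' : C_c(X, ℝ) →ₚ[ℝ] ℝ := PositiveLinearMap.mk₀ Λ fun f hf => hΛpos f hf
  have hΛ' : ∀ f, Λ' f = Λ f := fun _ => rfl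
  refine ⟨RealRMK.rieszMeasure Λ', ⟨?_⟩, fun f => ?_⟩
  -- Every compact set has mass at most `3C`, because its cutoff function is dominated by an element
  -- of `S` bounded by 3.
  · refine lt_of_le_of_lt ?_ (ENNReal.ofReal_lt_top (r := C * 3))
    rw [isOpen_univ.measure_eq_iSup_isCompact]
    refine iSup₂_le fun K _ => iSup_le fun hK => ?_
    obtain ⟨χ, hχ1, hχ0, hχ⟩ := exists_compactlySupported_eq_one hK
    refine (RealRMK.rieszMeasure_le_of_eq_one Λ' hχ0 hK hχ1).trans (ENNReal.ofReal_le_ofReal ?_)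
    obtain ⟨g, hg0, hg1, hg3⟩ := hcut _ χ.hasCompactSupport
    refine le_trans (OrderHomClass.mono Λ' (b := (g : C_c(X, ℝ))) fun x => ?_)
      ((hΛL g).trans_le (hbound g 3 (by norm_num) hg3))
    change χ x ≤ (g : C_c(X, ℝ)) x
    by_cases hx : x ∈ tsupport χ
    · exact (hχ x).trans (hg1 x hx)
    · rw [image_eq_zero_of_notMem_tsupport hx]
      exact hg0 x
  · rw [RealRMK.integral_rieszMeasure, hΛ']
    exact hΛL f

/-! ### The algebra `𝒞` and the energy functionals. -/

namespace DirichletForm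

variable {X : Type*} [TopologicalSpace X] [MeasurableSpace X] [BorelSpace X]
  {μ : Measure X} [IsFiniteMeasureOnCompacts μ] (D : DirichletForm μ)

theorem energy_add_left (f g h : D.core) : D.energy (f + g) h = D.energy f h + D.energy g h := by
  have : D.coreToDomain (f + g) = D.coreToDomain f + D.coreToDomain g :=
    Subtype.ext (map_add (toL2 μ) _ _)
  simp [energy, this]

theorem energy_smul_left (r : ℝ) (f h : D.core) : D.energy (r • f) h = r * D.energy f h := by
  have : D.coreToDomain (r • f) = r • D.coreToDomain f :=
    Subtype.ext (map_smul (toL2 μ) _ _)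
  simp [energy, this]

theorem energy_symm (f g : D.core) : D.energy f g = D.energy g f := D.symm _ _

theorem energy_add_right (f g h : D.core) : D.energy f (g + h) = D.energy f g + D.energy f h := by
  rw [energy_symm, energy_add_left, energy_symm, D.energy_symm h]

theorem energy_smul_right (r : ℝ) (f h : D.core) : D.energy f (r • h) = r * D.energy f h := by
  rw [energy_symm, energy_smul_left, energy_symm]

theorem approxForm_le_energy (n : ℕ) (g : D.core) :
    D.approxForm n (toL2 μ g) (toL2 μ g) ≤ D.energy g g := D.approxForm_le n (D.coreToDomain g)

theorem tendsto_approxForm_energy (g h : D.core) :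
    Filter.Tendsto (fun n => D.approxForm n (toL2 μ g) (toL2 μ h)) Filter.atTop
      (nhds (D.energy g h)) := D.tendsto_approxForm (D.coreToDomain g) (D.coreToDomain h)

/-- After division by a bound of `|f|` the truncation at 1 is inactive, so the unit contraction is
the positive part. -/
theorem sup_zero_mem_core {f : C_c(X, ℝ)} (hf : f ∈ D.core) : f ⊔ 0 ∈ D.core := by
  obtain ⟨M, hM, hfM⟩ := f.exists_abs_le
  have h1 : M⁻¹ • f ∈ D.core := D.core.smul_mem _ hf
  obtain ⟨v, hv, -⟩ := D.markov (D.coreToDomain ⟨_, h1⟩)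
  have h2 : (v : Lp ℝ 2 μ) = toL2 μ (M⁻¹ • (f ⊔ 0)) := by
    refine Lp.ext ?_
    filter_upwards [hv, coeFn_toL2 (μ := μ) (M⁻¹ • f), coeFn_toL2 (μ := μ) (M⁻¹ • (f ⊔ 0))]
      with x h3 h4 h5
    rw [h3, h5]
    change min (max ((toL2 μ (M⁻¹ • f)) x) 0) 1 = M⁻¹ * max (f x) 0
    rw [h4, CompactlySupportedContinuousMap.smul_apply, smul_eq_mul,
      mul_max_of_nonneg _ _ (by positivity), mul_zero]
    refine min_eq_left (max_le ?_ zero_le_one)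
    rw [inv_mul_le_one₀ hM]
    exact (abs_le.1 (hfM x)).2
  have h3 : M⁻¹ • (f ⊔ 0) ∈ D.core := by
    change toL2 μ _ ∈ D.domain
    rw [← h2]
    exact v.2
  have h4 := D.core.smul_mem M h3
  rwa [smul_smul, mul_inv_cancel₀ hM.ne', one_smul] at h4

section

variable [T2Space X] [LocallyCompactSpace X]

/-- The approximating energies of `g²` are bounded by `4M²ℰ(g, g)`, which suffices for membership in
`ℱ`. -/
theorem mul_self_mem_core {g : C_c(X, ℝ)} (hg : g ∈ D.core) : g * g ∈ D.core := by
  obtain ⟨M, hM, hgM⟩ := g.exists_abs_le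
  obtain ⟨u, hu, -⟩ := D.exists_of_approxForm_le (f := toL2 μ (g * g))
    (C := 4 * M ^ 2 * D.energy ⟨g, hg⟩ ⟨g, hg⟩) (fun n => (D.approxForm_sq_le n g hgM).trans
      (mul_le_mul_of_nonneg_left (D.approxForm_le_energy n ⟨g, hg⟩) (by positivity)))
  exact D.mem_domain_iff.2 ⟨u, hu⟩

theorem mul_mem_core {f g : C_c(X, ℝ)} (hf : f ∈ D.core) (hg : g ∈ D.core) : f * g ∈ D.core := by
  have h : f * g = (1 / 2 : ℝ) • ((f + g) * (f + g) - f * f - g * g) := by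
    ext x
    simp only [CompactlySupportedContinuousMap.smul_apply,
        CompactlySupportedContinuousMap.sub_apply, CompactlySupportedContinuousMap.add_apply,
        CompactlySupportedContinuousMap.mul_apply, smul_eq_mul]
    ring
  rw [h]
  exact D.core.smul_mem _ (D.core.sub_mem (D.core.sub_mem
    (D.mul_self_mem_core (D.core.add_mem hf hg)) (D.mul_self_mem_core hf)) (D.mul_self_mem_core hg))

/-- The product in the algebra `𝒞`. -/
def coreMul (f g : D.core) : D.core := ⟨f * g, D.mul_mem_core f.2 g.2⟩

theorem coreMul_comm (f g : D.core) : D.coreMul f g = D.coreMul g f := Subtype.ext (mul_comm _ _)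

theorem coreMul_add (f g h : D.core) : D.coreMul f (g + h) = D.coreMul f g + D.coreMul f h :=
  Subtype.ext (mul_add _ _ _)

theorem coreMul_smul (f g : D.core) (r : ℝ) : D.coreMul f (r • g) = r • D.coreMul f g :=
  Subtype.ext (mul_smul_comm _ _ _)

theorem add_coreMul (f g h : D.core) : D.coreMul (f + g) h = D.coreMul f h + D.coreMul g h :=
  Subtype.ext (add_mul _ _ _)

theorem smul_coreMul (f g : D.core) (r : ℝ) : D.coreMul (r • f) g = r • D.coreMul f g :=
  Subtype.ext (smul_mul_assoc _ _ _)

/-- The functional `f ↦ ℰ(fg, h) + ℰ(fh, g) - ℰ(gh, f)`. -/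
def carre (g h : D.core) : D.core →ₗ[ℝ] ℝ where
  toFun f := D.energy (D.coreMul f g) h + D.energy (D.coreMul f h) g - D.energy (D.coreMul g h) f
  map_add' f f' := by
    simp only [add_coreMul, energy_add_left, energy_add_right]; ring
  map_smul' r f := by
    simp only [smul_coreMul, energy_smul_left, energy_smul_right, RingHom.id_apply, smul_eq_mul]; ring

theorem carre_apply (g h f : D.core) : D.carre g h f =
    D.energy (D.coreMul f g) h + D.energy (D.coreMul f h) g - D.energy (D.coreMul g h) f := rfl

theorem carre_symm (g h : D.core) : D.carre g h = D.carre h g := by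
  ext f
  rw [carre_apply, carre_apply, coreMul_comm D g h]
  ring

theorem carre_add_left (g g' h : D.core) : D.carre (g + g') h = D.carre g h + D.carre g' h := by
  ext f
  simp only [LinearMap.add_apply, carre_apply, add_coreMul, coreMul_add, energy_add_left,
    energy_add_right]
  ring

theorem carre_smul_left (r : ℝ) (g h : D.core) : D.carre (r • g) h = r • D.carre g h := by
  ext f
  simp only [LinearMap.smul_apply, carre_apply, smul_coreMul, coreMul_smul, energy_smul_left,
    energy_smul_right, smul_eq_mul]
  ring

theorem isEnergyMeasure_iff (g h : D.core) (ν : SignedMeasure X) :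
    D.IsEnergyMeasure g h ν ↔
      ∀ f : D.core, 2 * ∫ᵛ x, (f : C_c(X, ℝ)) x ∂<•ν = D.carre g h f :=
  ⟨fun H f => (H f).choose_spec.choose_spec.choose_spec,
    fun H f => ⟨D.mul_mem_core f.2 g.2, D.mul_mem_core f.2 h.2, D.mul_mem_core g.2 h.2, H f⟩⟩

theorem tendsto_carre (g f : D.core) :
    Filter.Tendsto (fun n => 2 * D.approxForm n (toL2 μ g) (toL2 μ (f * g)) -
      D.approxForm n (toL2 μ (g * g)) (toL2 μ f)) Filter.atTop (nhds (D.carre g g f)) := by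
  have h1 := ((D.tendsto_approxForm_energy g (D.coreMul f g)).const_mul 2).sub
    (D.tendsto_approxForm_energy (D.coreMul g g) f)
  rw [energy_symm] at h1
  rw [carre_apply, ← two_mul]
  exact h1

theorem carre_nonneg (g : D.core) {f : D.core} (hf : ∀ x, 0 ≤ (f : C_c(X, ℝ)) x) :
    0 ≤ D.carre g g f :=
  ge_of_tendsto' (D.tendsto_carre g f) fun n =>
    sub_nonneg.2 (D.approxForm_carre_nonneg n (g : C_c(X, ℝ)) hf)

theorem carre_le (g : D.core) {f : D.core} {M : ℝ} (hM : 0 ≤ M)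
    (hf : ∀ x, (f : C_c(X, ℝ)) x ≤ M) : D.carre g g f ≤ 2 * D.energy g g * M :=
  le_of_tendsto' (D.tendsto_carre g f) fun n =>
    (D.approxForm_carre_le n (g : C_c(X, ℝ)) f hM hf).trans (by
      have := mul_le_mul_of_nonneg_left (D.approxForm_le_energy n g) hM
      linarith)

variable {D}

/-- Half the functional `carre g g` is positive and bounded by `ℰ(g, g) sup f`, so the Riesz
representation applies. -/
theorem exists_isEnergyMeasure_self (hD : D.IsRegular) (g : D.core) :
    ∃ ν : SignedMeasure X, 0 ≤ ν ∧ D.IsEnergyMeasure g g ν := by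
  obtain ⟨ν, hν, h⟩ := exists_finite_measure_of_functional D.core hD.dense_uniform
    (fun _ => D.sup_zero_mem_core) ((1 / 2 : ℝ) • D.carre g g) (C := D.energy g g)
    (fun f M hM hf => by
      have h1 := D.carre_le g hM hf
      rw [LinearMap.smul_apply, smul_eq_mul]
      linarith)
    (fun f hf => by
      rw [LinearMap.smul_apply, smul_eq_mul]
      exact mul_nonneg (by norm_num) (D.carre_nonneg g hf))
  refine ⟨ν.toSignedMeasure, Measure.zero_le_toSignedMeasure ν, ?_⟩
  rw [isEnergyMeasure_iff]
  intro f
  rw [VectorMeasure.integral_toSignedMeasure, h f, LinearMap.smul_apply, smul_eq_mul]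
  ring

end

end DirichletForm

/-! ### Densities with respect to signed measures. -/

namespace MeasureTheory.SignedMeasure

variable {X : Type*} [MeasurableSpace X]

theorem density_add_measure (ν ν' : SignedMeasure X) {b : X → ℝ} (hb : Measurable b) {K : ℝ}
    (hK : ∀ x, |b x| ≤ K) : (ν + ν').density b = ν.density b + ν'.density b := by
  ext A hA
  change _ = ν.density b A + ν'.density b A
  rw [density_apply _ hb hK, density_apply _ hb hK, density_apply _ hb hK,
    VectorMeasure.restrict_add, VectorMeasure.integral_add_vectorMeasure
    (integrable_of_bounded _ hb hK) (integrable_of_bounded _ hb hK)]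

theorem density_smul_measure (r : ℝ) (ν : SignedMeasure X) {b : X → ℝ} (hb : Measurable b) {K : ℝ}
    (hK : ∀ x, |b x| ≤ K) : (r • ν).density b = r • ν.density b := by
  ext A hA
  change _ = r • ν.density b A
  rw [density_apply _ hb hK, density_apply _ hb hK,
    VectorMeasure.restrict_smul, VectorMeasure.integral_smul_vectorMeasure]

theorem density_add (ν : SignedMeasure X) {b c : X → ℝ} (hb : Measurable b) (hc : Measurable c)
    {K L : ℝ} (hK : ∀ x, |b x| ≤ K) (hL : ∀ x, |c x| ≤ L) :
    ν.density (fun x => b x + c x) = ν.density b + ν.density c := by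
  ext A hA
  change _ = ν.density b A + ν.density c A
  rw [density_apply _ hb hK, density_apply _ hc hL,
    density_apply (b := fun x => b x + c x) _ (hb.add hc) (fun x => (abs_add_le _ _).trans (add_le_add (hK x) (hL x))),
    VectorMeasure.integral_fun_add (integrable_of_bounded _ hb hK) (integrable_of_bounded _ hc hL)]

theorem density_smul (ν : SignedMeasure X) (r : ℝ) {b : X → ℝ} (hb : Measurable b)
    {K : ℝ} (hK : ∀ x, |b x| ≤ K) :
    ν.density (fun x => r * b x) = r • ν.density b := by
  ext A hA
  change _ = r • ν.density b A
  rw [density_apply _ hb hK,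
    density_apply _ (hb.const_mul r) (K := |r| * K) (fun x => by
      rw [abs_mul]; exact mul_le_mul_of_nonneg_left (hK x) (abs_nonneg r))]
  exact VectorMeasure.integral_fun_smul _ _ r b

/-- The value type `β` is arbitrary so that `σ` can carry a whole vector of coefficients. -/
theorem setIntegral_simpleFunc (ν : SignedMeasure X) {β : Type*} (σ : SimpleFunc X β)
    (h : β → ℝ) {A : Set X} (hA : MeasurableSet A) :
    ∫ᵛ x in A, h (σ x) ∂<•ν = ∑ v ∈ σ.range, h v * ν (A ∩ σ ⁻¹' {v}) := by
  have h1 : A = ⋃ v ∈ σ.range, A ∩ σ ⁻¹' {v} := by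
    ext x; simp
  have hm : ∀ v, MeasurableSet (A ∩ σ ⁻¹' {v}) := fun v => hA.inter (σ.measurableSet_fiber v)
  have hint : VectorMeasure.Integrable ν (fun x => h (σ x)) := by
    have h2 : ∀ x, |h (σ x)| ≤ ∑ v ∈ σ.range, |h v| := fun x =>
      Finset.single_le_sum (f := fun v => |h v|) (fun v _ => abs_nonneg _) (σ.mem_range_self x)
    exact integrable_of_bounded ν (σ.map h).measurable h2
  conv_lhs => rw [h1]
  rw [VectorMeasure.setIntegral_biUnion_finset _ (fun v _ => hm v)
    (fun v _ w _ hvw => Set.disjoint_left.2 fun x hx hy => hvw (hx.2.symm.trans hy.2))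
    (fun v _ => hint.restrict)]
  refine Finset.sum_congr rfl fun v _ => ?_
  rw [VectorMeasure.setIntegral_congr_fun (g := fun _ => h v) (fun x hx => by
    simp only [show σ x = v from hx.2]), VectorMeasure.setIntegral_const]
  simp [mul_comm]

end MeasureTheory.SignedMeasure

/-- The product of bounded Borel functions. -/
def BoundedBorel.mul {X : Type*} [MeasurableSpace X] (b d : BoundedBorel X) : BoundedBorel X :=
  ⟨fun x => (b : X → ℝ) x * (d : X → ℝ) x, b.2.1.mul d.2.1, by
    obtain ⟨K, hK⟩ := b.2.2
    obtain ⟨L, hL⟩ := d.2.2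
    exact ⟨K * L, fun x => by
      rw [abs_mul]
      exact mul_le_mul (hK x) (hL x) (abs_nonneg _) ((abs_nonneg _).trans (hK x))⟩⟩

/-- The signed measure `b ν`, as a bilinear map. -/
def weightedMeasure (X : Type*) [MeasurableSpace X] :
    SignedMeasure X →ₗ[ℝ] BoundedBorel X →ₗ[ℝ] SignedMeasure X :=
  LinearMap.mk₂ ℝ (fun ν b => ν.density b)
    (fun ν ν' b => SignedMeasure.density_add_measure ν ν' b.2.1 b.2.2.choose_spec)
    (fun r ν b => SignedMeasure.density_smul_measure r ν b.2.1 b.2.2.choose_spec)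
    (fun ν b c => SignedMeasure.density_add ν b.2.1 c.2.1 b.2.2.choose_spec c.2.2.choose_spec)
    (fun r ν b => SignedMeasure.density_smul ν r b.2.1 b.2.2.choose_spec)

/-! ### Energy measures: existence, uniqueness, bilinearity, positivity. -/

namespace DirichletForm

variable {X : Type*} [TopologicalSpace X] [MeasurableSpace X] [BorelSpace X]
  {μ : Measure X} [IsFiniteMeasureOnCompacts μ] {D : DirichletForm μ}

section EnergyMeasure

variable [T2Space X] [LocallyCompactSpace X]

theorem exists_isEnergyMeasure (hD : D.IsRegular) (g h : D.core) :
    ∃ ν, D.IsEnergyMeasure g h ν := by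
  obtain ⟨ν₁, -, h₁⟩ := exists_isEnergyMeasure_self hD (g + h)
  obtain ⟨ν₂, -, h₂⟩ := exists_isEnergyMeasure_self hD g
  obtain ⟨ν₃, -, h₃⟩ := exists_isEnergyMeasure_self hD h
  -- Polarization of `Γ(g + h, g + h)`.
  refine ⟨(1 / 2 : ℝ) • (ν₁ - ν₂ - ν₃), ?_⟩
  rw [isEnergyMeasure_iff] at *
  intro f
  obtain ⟨M, -, hM⟩ := (f : C_c(X, ℝ)).exists_abs_le
  have hi : ∀ ν : SignedMeasure X, VectorMeasure.Integrable ν (f : C_c(X, ℝ)) := fun ν =>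
    ν.integrable_of_bounded (f : C_c(X, ℝ)).continuous.measurable hM
  rw [VectorMeasure.integral_smul_vectorMeasure,
    VectorMeasure.integral_sub_vectorMeasure (hi _) (hi _),
    VectorMeasure.integral_sub_vectorMeasure (hi _) (hi _), smul_eq_mul]
  have e₁ := h₁ f
  have e₂ := h₂ f
  have e₃ := h₃ f
  rw [carre_add_left, carre_symm, carre_symm D h, carre_add_left, carre_add_left] at e₁
  simp only [LinearMap.add_apply] at e₁
  rw [carre_symm D h g] at e₁
  linarith

theorem energyMeasure_spec (hD : D.IsRegular) (g h : D.core) :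
    D.IsEnergyMeasure g h (D.energyMeasure g h) := by
  rw [energyMeasure, dif_pos (exists_isEnergyMeasure hD g h)]
  exact (exists_isEnergyMeasure hD g h).choose_spec

variable [SecondCountableTopology X]

/-- `𝒞` is uniformly dense in `C_c(X, ℝ)` and `ν - ν'` has finite variation, so testing on `𝒞`
suffices. -/
theorem signedMeasure_ext_core (hD : D.IsRegular) {ν ν' : SignedMeasure X}
    (h : ∀ f : D.core, ∫ᵛ x, (f : C_c(X, ℝ)) x ∂<•ν = ∫ᵛ x, (f : C_c(X, ℝ)) x ∂<•ν') : ν = ν' := by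
  refine SignedMeasure.ext_of_integral_eq fun f => ?_
  have hi : ∀ (ν : SignedMeasure X) (f : C_c(X, ℝ)), VectorMeasure.Integrable ν f := fun ν f =>
    ν.integrable_of_bounded f.continuous.measurable f.exists_abs_le.choose_spec.2
  set V := (VectorMeasure.variation (ν - ν')).real Set.univ
  have hV : 0 ≤ V := measureReal_nonneg
  rw [← sub_eq_zero, ← VectorMeasure.integral_sub_vectorMeasure (hi _ _) (hi _ _)]
  refine abs_eq_zero.1 (le_antisymm (le_of_forall_pos_le_add fun ε hε => ?_) (abs_nonneg _))
  obtain ⟨g, hg⟩ := hD.dense_uniform f (ε / (V + 1)) (by positivity)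
  have h1 : ∫ᵛ x, (g : C_c(X, ℝ)) x ∂<•(ν - ν') = 0 := by
    rw [VectorMeasure.integral_sub_vectorMeasure (hi _ _) (hi _ _), h g, sub_self]
  have h2 : ∫ᵛ x, f x ∂<•(ν - ν') = ∫ᵛ x, (f x - (g : C_c(X, ℝ)) x) ∂<•(ν - ν') := by
    rw [VectorMeasure.integral_fun_sub (hi _ _) (hi _ _), h1, sub_zero]
  rw [h2]
  refine (SignedMeasure.abs_integral_le_variation (ν - ν') (fun x => (hg x).le)
    (by positivity)).trans ?_
  rw [zero_add, div_mul_eq_mul_div, div_le_iff₀ (by positivity)]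
  exact mul_le_mul_of_nonneg_left (by linarith) hε.le

theorem energyMeasure_unique (hD : D.IsRegular) {g h : D.core} {ν : SignedMeasure X}
    (hν : D.IsEnergyMeasure g h ν) : ν = D.energyMeasure g h := by
  refine signedMeasure_ext_core hD fun f => ?_
  have h1 := (D.isEnergyMeasure_iff _ _ _).1 hν f
  have h2 := (D.isEnergyMeasure_iff _ _ _).1 (energyMeasure_spec hD g h) f
  linarith

theorem energyMeasure_self_nonneg (hD : D.IsRegular) (g : D.core) : 0 ≤ D.energyMeasure g g := by
  obtain ⟨ν, hν, h⟩ := exists_isEnergyMeasure_self hD g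
  rwa [← energyMeasure_unique hD h]

theorem energyMeasure_symm (hD : D.IsRegular) (g h : D.core) :
    D.energyMeasure g h = D.energyMeasure h g := by
  refine energyMeasure_unique hD ?_
  rw [isEnergyMeasure_iff, carre_symm, ← isEnergyMeasure_iff]
  exact energyMeasure_spec hD g h

theorem energyMeasure_add_left (hD : D.IsRegular) (g g' h : D.core) :
    D.energyMeasure (g + g') h = D.energyMeasure g h + D.energyMeasure g' h := by
  refine (energyMeasure_unique hD ?_).symm
  rw [isEnergyMeasure_iff]
  intro f
  have hi : ∀ ν : SignedMeasure X, VectorMeasure.Integrable ν (f : C_c(X, ℝ)) := fun ν =>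
    ν.integrable_of_bounded (f : C_c(X, ℝ)).continuous.measurable
      (f : C_c(X, ℝ)).exists_abs_le.choose_spec.2
  rw [VectorMeasure.integral_add_vectorMeasure (hi _) (hi _), carre_add_left, LinearMap.add_apply,
    mul_add, (D.isEnergyMeasure_iff _ _ _).1 (energyMeasure_spec hD g h) f,
    (D.isEnergyMeasure_iff _ _ _).1 (energyMeasure_spec hD g' h) f]

theorem energyMeasure_smul_left (hD : D.IsRegular) (r : ℝ) (g h : D.core) :
    D.energyMeasure (r • g) h = r • D.energyMeasure g h := by
  refine (energyMeasure_unique hD ?_).symm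
  rw [isEnergyMeasure_iff]
  intro f
  rw [VectorMeasure.integral_smul_vectorMeasure, carre_smul_left, LinearMap.smul_apply,
    ← (D.isEnergyMeasure_iff _ _ _).1 (energyMeasure_spec hD g h) f, smul_eq_mul, smul_eq_mul]
  ring

/-- The energy measure as a bilinear map. -/
def energyMeasureₗ (hD : D.IsRegular) : D.core →ₗ[ℝ] D.core →ₗ[ℝ] SignedMeasure X :=
  LinearMap.mk₂ ℝ D.energyMeasure (energyMeasure_add_left hD) (energyMeasure_smul_left hD)
    (fun g h h' => by
      rw [energyMeasure_symm hD, energyMeasure_add_left hD, energyMeasure_symm hD h,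
        energyMeasure_symm hD h'])
    (fun r g h => by rw [energyMeasure_symm hD, energyMeasure_smul_left hD, energyMeasure_symm hD h])

/-- The matrix of the energy measures is nonnegative definite, also with variable coefficients. -/
theorem sum_density_energyMeasure_nonneg (hD : D.IsRegular) {ι : Type*} [Fintype ι] (a : ι → D.core)
    (b : ι → BoundedBorel X) {A : Set X} (hA : MeasurableSet A) :
    0 ≤ ∑ i, ∑ j, (D.energyMeasure (a i) (a j)).density
      (fun x => (b i : X → ℝ) x * (b j : X → ℝ) x) A := by
  choose K hK using fun i => (b i).2.2
  set C : ℝ := ∑ i, |K i|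
  have hC0 : 0 ≤ C := Finset.sum_nonneg fun i _ => abs_nonneg _
  have hC : ∀ x, (fun i => (b i : X → ℝ) x) ∈ Metric.closedBall (0 : ι → ℝ) C := fun x => by
    rw [mem_closedBall_zero_iff, pi_norm_le_iff_of_nonneg hC0]
    exact fun i => (hK i x).trans ((le_abs_self _).trans
      (Finset.single_le_sum (f := fun i => |K i|) (fun j _ => abs_nonneg _) (Finset.mem_univ i)))
  have hm : Measurable fun x i => (b i : X → ℝ) x := measurable_pi_lambda _ fun i => (b i).2.1
  -- All coefficients are approximated at once, inside a fixed ball, so that they are jointly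
  -- constant on the level sets and bounded convergence applies.
  let σ := SimpleFunc.approxOn _ hm (Metric.closedBall (0 : ι → ℝ) C) 0 (by simpa using hC0)
  have hσC : ∀ n x i, |σ n x i| ≤ C := fun n x i => by
    have h1 := SimpleFunc.approxOn_mem hm (s := Metric.closedBall (0 : ι → ℝ) C)
      (y₀ := 0) (by simpa using hC0) n x
    rw [mem_closedBall_zero_iff, pi_norm_le_iff_of_nonneg hC0] at h1
    exact h1 i
  have hσ : ∀ x i, Filter.Tendsto (fun n => σ n x i) Filter.atTop (nhds ((b i : X → ℝ) x)) :=
    fun x i => tendsto_pi_nhds.1 (SimpleFunc.tendsto_approxOn hm (by simpa using hC0)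
      (subset_closure (hC x))) i
  have hlim : Filter.Tendsto (fun n => ∑ i, ∑ j,
      ∫ᵛ x in A, σ n x i * σ n x j ∂<•(D.energyMeasure (a i) (a j))) Filter.atTop
      (nhds (∑ i, ∑ j, (D.energyMeasure (a i) (a j)).density
        (fun x => (b i : X → ℝ) x * (b j : X → ℝ) x) A)) := by
    refine tendsto_finsetSum _ fun i _ => tendsto_finsetSum _ fun j _ => ?_
    rw [SignedMeasure.density_apply (b := fun x => (b i : X → ℝ) x * (b j : X → ℝ) x) _
      (BoundedBorel.mul (b i) (b j)).2.1 (BoundedBorel.mul (b i) (b j)).2.2.choose_spec]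
    refine VectorMeasure.tendsto_integral_filter_of_norm_le_const (.of_forall fun n => ?_)
      ⟨C * C, .of_forall fun n => .of_forall fun x => ?_⟩
      (.of_forall fun x => (hσ x i).mul (hσ x j))
    · exact ((σ n).map fun v => v i * v j).measurable.aestronglyMeasurable
    · rw [Real.norm_eq_abs, abs_mul]
      exact mul_le_mul (hσC n x i) (hσC n x j) (abs_nonneg _) hC0
  refine ge_of_tendsto' hlim fun n => ?_
  have h1 : ∀ i j, ∫ᵛ x in A, σ n x i * σ n x j ∂<•(D.energyMeasure (a i) (a j)) =
      ∑ v ∈ (σ n).range, v i * v j * D.energyMeasure (a i) (a j) (A ∩ σ n ⁻¹' {v}) := fun i j =>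
    SignedMeasure.setIntegral_simpleFunc _ (σ n) (fun v => v i * v j) hA
  -- On the level set of `v` the double sum is the energy measure of the single function `∑ vᵢ aᵢ`,
  -- which is nonnegative.
  have h2 : ∑ i, ∑ j, ∫ᵛ x in A, σ n x i * σ n x j ∂<•(D.energyMeasure (a i) (a j)) =
      ∑ v ∈ (σ n).range, D.energyMeasure (∑ i, v i • a i) (∑ i, v i • a i) (A ∩ σ n ⁻¹' {v}) := by
    simp_rw [h1]
    rw [Finset.sum_congr rfl fun i _ => Finset.sum_comm, Finset.sum_comm]
    refine Finset.sum_congr rfl fun v _ => ?_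
    have h3 : D.energyMeasure (∑ i, v i • a i) (∑ i, v i • a i) =
        ∑ i, ∑ j, (v i * v j) • D.energyMeasure (a i) (a j) := by
      change energyMeasureₗ hD _ _ = _
      simp only [map_sum, map_smul, LinearMap.sum_apply, LinearMap.smul_apply, Finset.smul_sum,
        smul_smul]
      rw [Finset.sum_comm]
      simp_rw [mul_comm]
      rfl
    rw [h3]
    simp
  rw [h2]
  exact Finset.sum_nonneg fun v _ => energyMeasure_self_nonneg hD _ _
    (hA.inter ((σ n).measurableSet_fiber v))

end EnergyMeasure

end DirichletForm

/-! ### Cauchy–Schwarz and extension to completions. -/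

/-- Evaluation of signed measures at a set. -/
def MeasureTheory.SignedMeasure.evalₗ {X : Type*} [MeasurableSpace X] (A : Set X) :
    SignedMeasure X →ₗ[ℝ] ℝ where
  toFun ν := ν A
  map_add' _ _ := rfl
  map_smul' _ _ := rfl

/-- Cauchy–Schwarz inequality for measure valued forms. -/
theorem abs_apply_le_of_nonneg {X V : Type*} [MeasurableSpace X] [AddCommGroup V] [Module ℝ V]
    {G : V →ₗ[ℝ] V →ₗ[ℝ] SignedMeasure X} (hsymm : ∀ v w, G v w = G w v) (hpos : ∀ v, 0 ≤ G v v)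
    (v w : V) (A : Set X) :
    |G v w A| ≤ Real.sqrt (G v v Set.univ) * Real.sqrt (G w w Set.univ) := by
  by_cases hA : MeasurableSet A
  swap
  · rw [VectorMeasure.not_measurable _ hA, abs_zero]
    positivity
  have h1 := LinearMap.BilinForm.apply_sq_le_of_symm (G.compr₂ (SignedMeasure.evalₗ A))
    (fun v => hpos v A hA) ⟨fun v w => congrArg (fun ν : SignedMeasure X => ν A) (hsymm v w)⟩ v w
  have h2 : ∀ v, 0 ≤ G v v A ∧ G v v A ≤ G v v Set.univ := fun v => by
    have h3 : G v v A + G v v Aᶜ = G v v Set.univ := by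
      rw [VectorMeasure.of_compl hA]; ring
    have h4 : 0 ≤ G v v Aᶜ := hpos v Aᶜ hA.compl
    exact ⟨hpos v A hA, by linarith⟩
  rw [← Real.sqrt_mul ((h2 v).1.trans (h2 v).2)]
  refine Real.le_sqrt_of_sq_le ?_
  rw [sq_abs]
  exact h1.trans (mul_le_mul (h2 v).2 (h2 w).2 (h2 w).1 ((h2 v).1.trans (h2 v).2))

/-- Extension of a bounded bilinear form to the completion. -/
theorem exists_bilinear_extension {P : Type*} [SeminormedAddCommGroup P] [NormedSpace ℝ P]
    (β : P →L[ℝ] P →L[ℝ] ℝ) :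
    ∃ β' : UniformSpace.Completion P →L[ℝ] UniformSpace.Completion P →L[ℝ] ℝ,
      ∀ s t : P, β' s t = β s t := by
  let e : P →L[ℝ] UniformSpace.Completion P := UniformSpace.Completion.toComplL
  have hd : DenseRange e := UniformSpace.Completion.denseRange_coe
  have hi : IsUniformInducing e := UniformSpace.Completion.isUniformInducing_coe P
  -- Extension in the first variable, then, after a flip, in the second.
  refine ⟨((β.extend e).flip.extend e).flip, fun s t => ?_⟩
  have h1 : (β.extend e) (e s) = β s := β.extend_eq hd hi s
  have h2 : ((β.extend e).flip.extend e) (e t) = (β.extend e).flip t :=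
    (β.extend e).flip.extend_eq hd hi t
  change ((β.extend e).flip.extend e) (e t) (e s) = _
  rw [h2, ContinuousLinearMap.flip_apply, h1]

/-! ### The measure valued form on `𝒞 ⊗ ℬ_b(X)`. -/

namespace DirichletForm

variable {X : Type*} [TopologicalSpace X] [MeasurableSpace X] [BorelSpace X]
  {μ : Measure X} [IsFiniteMeasureOnCompacts μ] {D : DirichletForm μ}

theorem preOneForm_bilinear_ext {V : Type*} [AddCommGroup V] [Module ℝ V]
    {B B' : D.PreOneForm →ₗ[ℝ] D.PreOneForm →ₗ[ℝ] V}
    (h : ∀ a b c d, B (D.preTmul a b) (D.preTmul c d) = B' (D.preTmul a b) (D.preTmul c d)) :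
    B = B' :=
  TensorProduct.ext' fun a b => TensorProduct.ext' fun c d => h a b c d

variable [T2Space X] [LocallyCompactSpace X] [SecondCountableTopology X]

/-- The map `(c, d) ↦ b d Γ(a, c)`. -/
def preGammaAux (hD : D.IsRegular) (a : D.core) (b : BoundedBorel X) :
    D.core →ₗ[ℝ] BoundedBorel X →ₗ[ℝ] SignedMeasure X :=
  LinearMap.mk₂ ℝ (fun c d => weightedMeasure X (energyMeasureₗ hD a c) (BoundedBorel.mul b d))
    (fun c c' d => by simp only [map_add, LinearMap.add_apply])
    (fun r c d => by simp only [map_smul, LinearMap.smul_apply])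
    (fun c d d' => by
      rw [← map_add]; congr 1; exact Subtype.ext (funext fun x => mul_add _ _ _))
    (fun r c d => by
      rw [← map_smul]; congr 1; exact Subtype.ext (funext fun x => mul_left_comm _ _ _))

/-- The map `c ⊗ d ↦ b d Γ(a, c)`. -/
def preGammaLeft (hD : D.IsRegular) (a : D.core) (b : BoundedBorel X) :
    D.core ⊗[ℝ] BoundedBorel X →ₗ[ℝ] SignedMeasure X :=
  TensorProduct.lift (preGammaAux hD a b)

theorem preGammaLeft_tmul (hD : D.IsRegular) (a c : D.core) (b d : BoundedBorel X) :
    preGammaLeft hD a b (c ⊗ₜ[ℝ] d) =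
      weightedMeasure X (energyMeasureₗ hD a c) (BoundedBorel.mul b d) :=
  TensorProduct.lift.tmul _ _

/-- The map `(a, b) ↦ (c ⊗ d ↦ b d Γ(a, c))`. -/
def preGammaRight (hD : D.IsRegular) : D.core →ₗ[ℝ] BoundedBorel X →ₗ[ℝ]
    D.core ⊗[ℝ] BoundedBorel X →ₗ[ℝ] SignedMeasure X :=
  LinearMap.mk₂ ℝ (preGammaLeft hD)
    (fun a a' b => TensorProduct.ext' fun c d => by
      simp only [LinearMap.add_apply, preGammaLeft_tmul, map_add])
    (fun r a b => TensorProduct.ext' fun c d => by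
      simp only [LinearMap.smul_apply, preGammaLeft_tmul, map_smul])
    (fun a b b' => TensorProduct.ext' fun c d => by
      simp only [LinearMap.add_apply, preGammaLeft_tmul]
      rw [← map_add]; congr 1; exact Subtype.ext (funext fun x => add_mul _ _ _))
    (fun r a b => TensorProduct.ext' fun c d => by
      simp only [LinearMap.smul_apply, preGammaLeft_tmul]
      rw [← map_smul]; congr 1; exact Subtype.ext (funext fun x => mul_assoc _ _ _))

/-- The bilinear map on `𝒞 ⊗ ℬ_b(X)` with `(a ⊗ b, c ⊗ d) ↦ b d Γ(a, c)`. -/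
def preGamma (hD : D.IsRegular) : D.PreOneForm →ₗ[ℝ] D.PreOneForm →ₗ[ℝ] SignedMeasure X :=
  TensorProduct.lift (preGammaRight hD)

theorem preGamma_tmul (hD : D.IsRegular) (a c : D.core) (b d : BoundedBorel X) :
    preGamma hD (D.preTmul a b) (D.preTmul c d) =
      (D.energyMeasure a c).density (fun x => (b : X → ℝ) x * (d : X → ℝ) x) :=
  preGammaLeft_tmul hD a c b d

theorem preGamma_symm (hD : D.IsRegular) (s t : D.PreOneForm) :
    preGamma hD s t = preGamma hD t s := by
  have h : preGamma hD = (preGamma hD).flip := preOneForm_bilinear_ext fun a b c d => by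
    rw [LinearMap.flip_apply, preGamma_tmul, preGamma_tmul, energyMeasure_symm hD]
    simp_rw [mul_comm]
  rw [h, LinearMap.flip_apply, ← h]

theorem preGamma_nonneg (hD : D.IsRegular) (t : D.PreOneForm) : 0 ≤ preGamma hD t t := by
  intro A hA
  obtain ⟨S, rfl⟩ : ∃ S : Finset (D.core × BoundedBorel X), t = ∑ i ∈ S, D.preTmul i.1 i.2 :=
    TensorProduct.exists_finset t
  have h := sum_density_energyMeasure_nonneg hD (ι := S) (fun i => i.1.1) (fun i => i.1.2) hA
  rw [← Finset.sum_coe_sort]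
  simp only [map_sum, LinearMap.sum_apply, preGamma_tmul]
  rw [Finset.sum_comm]
  simpa using h

theorem isOneFormProduct_preGamma (hD : D.IsRegular) :
    D.IsOneFormProduct ((preGamma hD).compr₂ (SignedMeasure.evalₗ Set.univ)) where
  symm s t := congrArg (fun ν : SignedMeasure X => ν Set.univ) (preGamma_symm hD s t)
  nonneg t := preGamma_nonneg hD t Set.univ .univ
  tmul a c b d := by
    change preGamma hD _ _ Set.univ = _
    rw [preGamma_tmul, SignedMeasure.density_univ]

/-- Bilinear forms that agree on simple tensors coincide, so the chosen scalar product is the total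
mass of `preGamma`. -/
theorem oneFormProduct_eq (hD : D.IsRegular) (s t : D.PreOneForm) :
    D.oneFormProduct s t = preGamma hD s t Set.univ := by
  have H : ∃ B, D.IsOneFormProduct B := ⟨_, isOneFormProduct_preGamma hD⟩
  have h1 : D.IsOneFormProduct D.oneFormProduct := by
    rw [oneFormProduct, dif_pos H]
    exact H.choose_spec
  have h2 : D.oneFormProduct = (preGamma hD).compr₂ (SignedMeasure.evalₗ Set.univ) :=
    preOneForm_bilinear_ext fun a b c d => by
      rw [h1.tmul, (isOneFormProduct_preGamma hD).tmul]
  rw [h2]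
  rfl

theorem preOneForm_inner (hD : D.IsRegular) (s t : D.PreOneForm) :
    inner ℝ s t = preGamma hD s t Set.univ := oneFormProduct_eq hD s t

theorem abs_preGamma_le (hD : D.IsRegular) (s t : D.PreOneForm) (A : Set X) :
    |preGamma hD s t A| ≤ ‖s‖ * ‖t‖ := by
  have h := abs_apply_le_of_nonneg (preGamma_symm hD) (preGamma_nonneg hD) s t A
  rwa [← preOneForm_inner, ← preOneForm_inner, real_inner_self_eq_norm_mul_norm,
    real_inner_self_eq_norm_mul_norm, Real.sqrt_mul_self (norm_nonneg _),
    Real.sqrt_mul_self (norm_nonneg _)] at h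

theorem inner_tmul (hD : D.IsRegular) (a c : D.core) (b d : BoundedBorel X) :
    inner ℝ (D.tmul a b) (D.tmul c d) =
      ∫ᵛ x, (b : X → ℝ) x * (d : X → ℝ) x ∂<•(D.energyMeasure a c) := by
  rw [tmul, tmul, UniformSpace.Completion.inner_coe, preOneForm_inner hD, preGamma_tmul,
    SignedMeasure.density_univ]

end DirichletForm

/-! ### Extension to the Hilbert space `ℋ`. -/

namespace DirichletForm

variable {X : Type*} [TopologicalSpace X] [MeasurableSpace X] [BorelSpace X]
  {μ : Measure X} [IsFiniteMeasureOnCompacts μ] {D : DirichletForm μ}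

/-- Two extensions agree on classes of elements of `𝒞 ⊗ ℬ_b(X)`. -/
theorem IsEnergyExtension.eq_coe {G G' : D.OneForm →ₗ[ℝ] D.OneForm →ₗ[ℝ] SignedMeasure X}
    (hG : D.IsEnergyExtension G) (hG' : D.IsEnergyExtension G') (s t : D.PreOneForm) :
    G (s : D.OneForm) (t : D.OneForm) = G' (s : D.OneForm) (t : D.OneForm) := by
  let e : D.PreOneForm →ₗ[ℝ] D.OneForm :=
    (UniformSpace.Completion.toComplL : D.PreOneForm →L[ℝ] D.OneForm).toLinearMap
  have h : G.compl₁₂ e e = G'.compl₁₂ e e := preOneForm_bilinear_ext fun a b c d =>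
    (hG.tmul a c b d).trans (hG'.tmul a c b d).symm
  exact LinearMap.congr_fun₂ h s t

/-- A measure valued bilinear map on `ℋ` with the bound `|G(ω, η)(A)| ≤ ‖ω‖ ‖η‖` is continuous
after integration of a bounded Borel function. -/
theorem continuous_integral_of_bound {G : D.OneForm →ₗ[ℝ] D.OneForm →ₗ[ℝ] SignedMeasure X}
    (hG : ∀ ω η A, |G ω η A| ≤ ‖ω‖ * ‖η‖) (φ : BoundedBorel X) :
    Continuous fun p : D.OneForm × D.OneForm => ∫ᵛ x, (φ : X → ℝ) x ∂<•(G p.1 p.2) := by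
  obtain ⟨K, hK⟩ := φ.2.2
  have hK' : ∀ x, |(φ : X → ℝ) x| ≤ max K 0 := fun x => (hK x).trans (le_max_left _ _)
  have hi : ∀ ν : SignedMeasure X, VectorMeasure.Integrable ν (φ : X → ℝ) := fun ν =>
    ν.integrable_of_bounded φ.2.1 hK
  let I : SignedMeasure X →ₗ[ℝ] ℝ :=
    { toFun := fun ν => ∫ᵛ x, (φ : X → ℝ) x ∂<•ν
      map_add' := fun ν ν' => VectorMeasure.integral_add_vectorMeasure (hi ν) (hi ν')
      map_smul' := fun r ν => VectorMeasure.integral_smul_vectorMeasure _ r }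
  let B : D.OneForm →L[ℝ] D.OneForm →L[ℝ] ℝ := (G.compr₂ I).mkContinuous₂ (max K 0 * 2)
    fun ω η => (SignedMeasure.abs_integral_le (G ω η) (fun A _ => hG ω η A) hK'
      (le_max_right _ _)).trans_eq (by ring)
  exact B.isBoundedBilinearMap.continuous

/-- A measure valued bilinear map on `ℋ` with the bound `|G(ω, η)(A)| ≤ ‖ω‖ ‖η‖` is continuous
after evaluation at a set. -/
theorem continuous_apply_of_bound {G : D.OneForm →ₗ[ℝ] D.OneForm →ₗ[ℝ] SignedMeasure X}
    (hG : ∀ ω η A, |G ω η A| ≤ ‖ω‖ * ‖η‖) (A : Set X) :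
    Continuous fun p : D.OneForm × D.OneForm => G p.1 p.2 A := by
  let B : D.OneForm →L[ℝ] D.OneForm →L[ℝ] ℝ :=
    (G.compr₂ (SignedMeasure.evalₗ A)).mkContinuous₂ 1
      fun ω η => (hG ω η A).trans_eq (by ring)
  exact B.isBoundedBilinearMap.continuous

theorem ext_of_bound {G G' : D.OneForm →ₗ[ℝ] D.OneForm →ₗ[ℝ] SignedMeasure X}
    (hG : ∀ ω η A, |G ω η A| ≤ ‖ω‖ * ‖η‖) (hG' : ∀ ω η A, |G' ω η A| ≤ ‖ω‖ * ‖η‖)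
    (h : ∀ s t : D.PreOneForm,
      G (s : D.OneForm) (t : D.OneForm) = G' (s : D.OneForm) (t : D.OneForm)) : G = G' := by
  refine LinearMap.ext₂ fun ω η => VectorMeasure.ext fun A _ => ?_
  induction ω, η using UniformSpace.Completion.induction_on₂ with
  | hp => exact isClosed_eq (continuous_apply_of_bound hG A) (continuous_apply_of_bound hG' A)
  | ih s t => rw [h]

variable [T2Space X] [LocallyCompactSpace X] [SecondCountableTopology X]

/-- Separate continuity suffices: density in `ω` is used first with the second argument in the dense
subspace; symmetry then makes that argument arbitrary. -/
theorem ext_of_continuous {G G' : D.OneForm →ₗ[ℝ] D.OneForm →ₗ[ℝ] SignedMeasure X}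
    (hs : ∀ ω η, G ω η = G η ω) (hs' : ∀ ω η, G' ω η = G' η ω)
    (hG : ∀ (η : D.OneForm) (f : C_c(X, ℝ)), Continuous fun ω => ∫ᵛ x, f x ∂<•(G ω η))
    (hG' : ∀ (η : D.OneForm) (f : C_c(X, ℝ)), Continuous fun ω => ∫ᵛ x, f x ∂<•(G' ω η))
    (h : ∀ s t : D.PreOneForm,
      G (s : D.OneForm) (t : D.OneForm) = G' (s : D.OneForm) (t : D.OneForm)) : G = G' := by
  have h1 : ∀ (t : D.PreOneForm) (ω : D.OneForm), G ω (t : D.OneForm) = G' ω (t : D.OneForm) := by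
    refine fun t ω => SignedMeasure.ext_of_integral_eq fun f => ?_
    induction ω using UniformSpace.Completion.induction_on with
    | hp => exact isClosed_eq (hG _ f) (hG' _ f)
    | ih s => rw [h]
  refine LinearMap.ext₂ fun ω η => SignedMeasure.ext_of_integral_eq fun f => ?_
  induction ω using UniformSpace.Completion.induction_on with
  | hp => exact isClosed_eq (hG _ f) (hG' _ f)
  | ih s => rw [hs, h1, hs']

/-- Existence of the weighted energy measures. -/
theorem exists_energyExtension (hD : D.IsRegular) :
    ∃ G : D.OneForm →ₗ[ℝ] D.OneForm →ₗ[ℝ] SignedMeasure X,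
      (∀ s t : D.PreOneForm, G (s : D.OneForm) (t : D.OneForm) = preGamma hD s t) ∧
      ∀ ω η A, |G ω η A| ≤ ‖ω‖ * ‖η‖ := by
  have hβ : ∀ A : Set X, ∃ β : D.OneForm →L[ℝ] D.OneForm →L[ℝ] ℝ,
      (∀ s t : D.PreOneForm, β (s : D.OneForm) (t : D.OneForm) = preGamma hD s t A) ∧
      ∀ ω η, |β ω η| ≤ ‖ω‖ * ‖η‖ := fun A => by
    obtain ⟨β, hβ⟩ := exists_bilinear_extension
      (((preGamma hD).compr₂ (SignedMeasure.evalₗ A)).mkContinuous₂ 1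
        fun s t => (abs_preGamma_le hD s t A).trans_eq (by ring))
    refine ⟨β, hβ, fun ω η => ?_⟩
    induction ω, η using UniformSpace.Completion.induction_on₂ with
    | hp =>
      exact isClosed_le (continuous_abs.comp β.isBoundedBilinearMap.continuous) (by fun_prop)
    | ih s t =>
      rw [hβ, UniformSpace.Completion.norm_coe, UniformSpace.Completion.norm_coe]
      exact abs_preGamma_le hD s t A
  choose β hβ hβ' using hβ
  have hν : ∀ ω η, ∃ ν : SignedMeasure X, ∀ A, ν A = β A ω η := by
    refine fun ω η => SignedMeasure.exists_of_forall_approx _ fun ε hε => ?_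
    -- The error is at most `δ(‖η‖ + 1) + ‖ω‖δ`, independently of `A`; `δ ≤ 1` gives `‖t‖ ≤ ‖η‖ +
    -- 1`.
    set δ : ℝ := min 1 (ε / (‖ω‖ + ‖η‖ + 1))
    have hδ : 0 < δ := by positivity
    have hδ1 : δ ≤ 1 := min_le_left _ _
    have hδε : δ * (‖ω‖ + ‖η‖ + 1) ≤ ε := by
      rw [← le_div_iff₀ (by positivity)]
      exact min_le_right _ _
    have happ : ∀ ω : D.OneForm, ∃ s : D.PreOneForm, ‖(s : D.OneForm) - ω‖ ≤ δ := fun ω => by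
      obtain ⟨s, hs⟩ := Metric.denseRange_iff.1 (UniformSpace.Completion.denseRange_coe
        (α := D.PreOneForm)) ω δ hδ
      refine ⟨s, ?_⟩
      rw [← dist_eq_norm, dist_comm]
      exact hs.le
    obtain ⟨s, hs⟩ := happ ω
    obtain ⟨t, ht⟩ := happ η
    refine ⟨preGamma hD s t, fun A => ?_⟩
    rw [← hβ]
    have h1 : β A (s : D.OneForm) (t : D.OneForm) - β A ω η =
        β A ((s : D.OneForm) - ω) (t : D.OneForm) + β A ω ((t : D.OneForm) - η) := by
      simp only [map_sub, sub_apply]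
      ring
    have h2 : ‖(t : D.OneForm)‖ ≤ ‖η‖ + 1 := by
      have := norm_add_le ((t : D.OneForm) - η) η
      rw [sub_add_cancel] at this
      linarith
    rw [h1]
    calc _ ≤ _ := abs_add_le _ _
      _ ≤ ‖(s : D.OneForm) - ω‖ * ‖(t : D.OneForm)‖ + ‖ω‖ * ‖(t : D.OneForm) - η‖ :=
        add_le_add (hβ' _ _ _) (hβ' _ _ _)
      _ ≤ δ * (‖η‖ + 1) + ‖ω‖ * δ := by gcongr
      _ = δ * (‖ω‖ + ‖η‖ + 1) := by ring
      _ ≤ ε := hδε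
  choose ν hν using hν
  refine ⟨LinearMap.mk₂ ℝ ν (fun ω ω' η => ?_) (fun r ω η => ?_) (fun ω η η' => ?_)
    (fun r ω η => ?_), fun s t => ?_, fun ω η A => ?_⟩
  · refine VectorMeasure.ext fun A _ => ?_
    change _ = ν ω η A + ν ω' η A
    rw [hν, hν, hν, map_add, add_apply]
  · refine VectorMeasure.ext fun A _ => ?_
    change _ = r • ν ω η A
    rw [hν, hν, map_smul, smul_apply]
  · refine VectorMeasure.ext fun A _ => ?_
    change _ = ν ω η A + ν ω η' A
    rw [hν, hν, hν, map_add]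
  · refine VectorMeasure.ext fun A _ => ?_
    change _ = r • ν ω η A
    rw [hν, hν, map_smul]
  · refine VectorMeasure.ext fun A _ => ?_
    exact (hν _ _ _).trans (hβ A s t)
  · change |ν ω η A| ≤ _
    rw [hν]
    exact hβ' A ω η

end DirichletForm

end

/-! ### The main theorem. -/

theorem lemmaL {X : Type*} [TopologicalSpace X] [T2Space X] [LocallyCompactSpace X]
    [SecondCountableTopology X] [MeasurableSpace X] [BorelSpace X]
    (μ : Measure X) [μ.Regular] [μ.IsOpenPosMeasure]
    (D : DirichletForm μ) (hD : D.IsRegular) :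
    -- the energy measures are well defined
    (∀ g h : D.core, D.IsEnergyMeasure g h (D.energyMeasure g h) ∧
      ∀ ν, D.IsEnergyMeasure g h ν → ν = D.energyMeasure g h) ∧
    -- the scalar product of 1-forms is well defined
    (∀ (a c : D.core) (b d : BoundedBorel X),
      inner ℝ (D.tmul a b) (D.tmul c d) =
        ∫ᵛ x, (b : X → ℝ) x * (d : X → ℝ) x ∂<•(D.energyMeasure a c)) ∧
    -- the weighted energy measures
    ∃ ΓH : D.OneForm →ₗ[ℝ] D.OneForm →ₗ[ℝ] SignedMeasure X,
      D.IsEnergyExtension ΓH ∧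
      (∀ ω, 0 ≤ ΓH ω ω) ∧
      (∀ ω η, ΓH ω η Set.univ = inner ℝ ω η) ∧
      (∀ φ : BoundedBorel X,
        Continuous fun p : D.OneForm × D.OneForm => ∫ᵛ x, (φ : X → ℝ) x ∂<•(ΓH p.1 p.2)) ∧
      -- uniqueness among nonnegative extensions with the right total mass
      (∀ G, D.IsEnergyExtension G → (∀ ω, 0 ≤ G ω ω) →
        (∀ ω, G ω ω Set.univ = inner ℝ ω ω) → G = ΓH) ∧
      -- uniqueness among extensions that are separately continuous for the vague topology
      (∀ G, D.IsEnergyExtension G →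
        (∀ (η : D.OneForm) (f : C_c(X, ℝ)), Continuous fun ω => ∫ᵛ x, f x ∂<•(G ω η)) →
        G = ΓH) := by
  refine ⟨fun g h => ⟨DirichletForm.energyMeasure_spec hD g h,
    fun ν hν => DirichletForm.energyMeasure_unique hD hν⟩,
    fun a c b d => DirichletForm.inner_tmul hD a c b d, ?_⟩
  obtain ⟨Γ, hΓ, hbound⟩ := DirichletForm.exists_energyExtension hD
  have hsymm : ∀ ω η, Γ ω η = Γ η ω := by
    refine fun ω η => VectorMeasure.ext fun A _ => ?_
    induction ω, η using UniformSpace.Completion.induction_on₂ with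
    | hp =>
      exact isClosed_eq (DirichletForm.continuous_apply_of_bound hbound A)
        ((DirichletForm.continuous_apply_of_bound hbound A).comp continuous_swap)
    | ih s t => rw [hΓ, hΓ, DirichletForm.preGamma_symm]
  have hext : D.IsEnergyExtension Γ :=
    ⟨hsymm, fun a c b d => (hΓ _ _).trans (DirichletForm.preGamma_tmul hD a c b d)⟩
  have hcont := fun φ => DirichletForm.continuous_integral_of_bound hbound φ
  refine ⟨Γ, hext, fun ω A hA => ?_, fun ω η => ?_, hcont, fun G hG hpos hmass => ?_,
    fun G hG hGc => ?_⟩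
  · change 0 ≤ Γ ω ω A
    induction ω using UniformSpace.Completion.induction_on with
    | hp =>
      exact isClosed_le continuous_const ((DirichletForm.continuous_apply_of_bound hbound A).comp
        (continuous_id.prodMk continuous_id))
    | ih s => rw [hΓ]; exact DirichletForm.preGamma_nonneg hD s A hA
  · induction ω, η using UniformSpace.Completion.induction_on₂ with
    | hp =>
      exact isClosed_eq (DirichletForm.continuous_apply_of_bound hbound _)
        (continuous_fst.inner continuous_snd)
    | ih s t => rw [hΓ, UniformSpace.Completion.inner_coe, DirichletForm.preOneForm_inner hD]
  -- Nonnegativity and the mass condition give `G` the same Cauchy–Schwarz bound, hence continuity.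
  · refine DirichletForm.ext_of_bound (fun ω η A => ?_) hbound (hG.eq_coe hext)
    have h := abs_apply_le_of_nonneg hG.symm hpos ω η A
    rwa [hmass, hmass, real_inner_self_eq_norm_mul_norm, real_inner_self_eq_norm_mul_norm,
      Real.sqrt_mul_self (norm_nonneg _), Real.sqrt_mul_self (norm_nonneg _)] at h
  · refine DirichletForm.ext_of_continuous hG.symm hsymm hGc (fun η f => ?_) (hG.eq_coe hext)
    let φ : BoundedBorel X := ⟨f, f.continuous.measurable, f.exists_abs_le.choose,
      f.exists_abs_le.choose_spec.2⟩
    have hprod : Continuous fun ω : D.OneForm => (ω, η) := by fun_prop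
    exact Continuous.comp (f := fun ω : D.OneForm => (ω, η)) (hcont φ) hprod
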